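/- Let $n\ge 2$, let $\Gamma=\operatorname{SL}_n(\mathbb Z)$, and let $\Lambda<\Gamma$ be the subgroup of upper triangular matrices. Let $G=\operatorname{SL}_n(\mathbb R)$, let $P<G$ be the subgroup of upper triangular matrices, and let $\Gamma$ act by left multiplication on $G/P$ with its quotient topology. For a subgroup $K<\Gamma$ let $LK\subseteq B(\ell^2\Gamma)$ be the von Neumann algebra generated by the left translation operators $\lambda_g$, $g\in K$, and let $\tau(x)=\langle x\delta_e,\delta_e\rangle$ be the canonical trace on $L\Gamma$. A von Neumann subalgebra $A\subseteq L\Gamma$ is amenable if there is a state $\varphi$ on $B(L^2(A,\tau))$ such that $\varphi(aT)=\varphi(Ta)$ for all $a\in A$ and $T\in B(L^2(A,\tau))$, and $\varphi|_A=\tau$. Then: 1. $\Lambda$ is singular in $\Gamma$ with respect to the action on $G/P$. That is, $\Gamma$ is countable, $\Lambda$ is amenable, $G/P$ is a compact Hausdorff space on which $\Gamma$ acts by homeomorphisms, and for every $\Lambda$-invariant Borel probability measure $\mu$ on $G/P$ and every $g\in\Gamma\setminus\Lambda$ the measures $g\cdot\mu$ and $\mu$ are mutually singular. 2. $L\Lambda$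 is maximal amenable in $L\Gamma$: it is amenable, and every amenable von Neumann algebra $A$ with $L\Lambda\subseteq A\subseteq L\Gamma$ is equal to $L\Lambda$. 3. The center of $L\Lambda$ is diffuse, that is, it has no minimal projection. -/

import Mathlib

open scoped lp ComplexOrder

noncomputable section

/-! ## Amenable groups and singular subgroups -/

/-- A discrete group is amenable if `ℓ^∞(G, ℝ)` carries a left invariant mean, that is, a positive
unital linear functional `m` which takes the same value at `f` and at each left translate
`x ↦ f (g⁻¹ x)` of `f`. -/
def IsAmenableGroup (G : Type*) [Group G] : Prop :=
  ∃ m : lp (fun _ : G => ℝ) ⊤ →ₗ[ℝ] ℝ,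
    m 1 = 1 ∧
    (∀ f : lp (fun _ : G => ℝ) ⊤, (∀ x, 0 ≤ f x) → 0 ≤ m f) ∧
    (∀ (g : G) (f f' : lp (fun _ : G => ℝ) ⊤), (∀ x, f' x = f (g⁻¹ * x)) → m f' = m f)

/-- Let the countable discrete group `Γ` act on `X`, where `X` has its Borel σ-algebra. The
subgroup `Λ` is singular in `Γ` with respect to `X` if `Λ` is amenable, `X` is a compact Hausdorff
space on which `Γ` acts by homeomorphisms, and for every `Λ`-invariant Borel probability measure
`μ` on `X` and every `g ∈ Γ \ Λ` the measures `g · μ` and `μ` are mutually singular. -/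
structure IsSingularSubgroup {Γ : Type*} [Group Γ] (Λ : Subgroup Γ) (X : Type*)
    [TopologicalSpace X] [MeasurableSpace X] [BorelSpace X] [MulAction Γ X] : Prop where
  countable : Countable Γ
  amenable : IsAmenableGroup Λ
  compact : CompactSpace X
  t2 : T2Space X
  continuous_smul : ∀ g : Γ, Continuous fun x : X => g • x
  mutuallySingular : ∀ μ : MeasureTheory.Measure X, MeasureTheory.IsProbabilityMeasure μ →
    (∀ h ∈ Λ, μ.map (fun x => h • x) = μ) →
    ∀ g : Γ, g ∉ Λ → (μ.map fun x => g • x).MutuallySingular μ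

/-! ## Von Neumann algebras -/

namespace VonNeumannAlgebra

variable {H : Type*} [NormedAddCommGroup H] [InnerProductSpace ℂ H] [CompleteSpace H]

/-- The commutant of the star-closure of a set of operators. -/
def commutantOf (S : Set (H →L[ℂ] H)) : VonNeumannAlgebra H where
  toStarSubalgebra := StarSubalgebra.centralizer ℂ S
  centralizer_centralizer' := by
    change Set.centralizer (Set.centralizer
      (StarSubalgebra.centralizer ℂ S : Set (H →L[ℂ] H))) = StarSubalgebra.centralizer ℂ S
    rw [StarSubalgebra.coe_centralizer, Set.centralizer_centralizer_centralizer]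

/-- The von Neumann algebra generated by a set of operators: the double commutant of its
star-closure. -/
def generatedBy (S : Set (H →L[ℂ] H)) : VonNeumannAlgebra H :=
  (commutantOf S).commutant

/-- The center `A ∩ A'` of a von Neumann algebra `A`, as the commutant of `A ∪ A'`. -/
def center (A : VonNeumannAlgebra H) : VonNeumannAlgebra H :=
  commutantOf ((A : Set (H →L[ℂ] H)) ∪ (A.commutant : Set (H →L[ℂ] H)))

theorem mem_commutantOf {S : Set (H →L[ℂ] H)} {z : H →L[ℂ] H} :
    z ∈ commutantOf S ↔ ∀ g ∈ S, g * z = z * g ∧ star g * z = z * star g :=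
  StarSubalgebra.mem_centralizer_iff ℂ

theorem mem_center {A : VonNeumannAlgebra H} {z : H →L[ℂ] H} :
    z ∈ A.center ↔ z ∈ A ∧ ∀ a ∈ A, a * z = z * a := by
  rw [center, mem_commutantOf]
  constructor
  · intro h
    refine ⟨?_, fun a ha => (h a (Or.inl ha)).1⟩
    rw [← A.commutant_commutant, mem_commutant_iff]
    exact fun b hb => (h b (Or.inr hb)).1
  · rintro ⟨hz, hc⟩ g (hg | hg)
    · exact ⟨hc g hg, hc _ (star_mem hg)⟩
    · have hg' : g ∈ A.commutant := hg
      exact ⟨((mem_commutant_iff.1 hg') z hz).symm,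
        ((mem_commutant_iff.1 (star_mem hg')) z hz).symm⟩

/-- A von Neumann algebra is diffuse if it has no minimal projections: every nonzero projection
`p` of `A` has a subprojection `q` in `A` with `0 ≠ q ≠ p`. -/
def IsDiffuse (A : VonNeumannAlgebra H) : Prop :=
  ∀ p ∈ A, IsStarProjection p → p ≠ 0 →
    ∃ q ∈ A, IsStarProjection q ∧ p * q = q ∧ q ≠ 0 ∧ q ≠ p

/-- The closure of `A ξ`. If the vector state of `ξ` is a faithful trace `τ` on `A`, this is the
Hilbert space `L²(A, τ)`, with `a ξ` in the role of the vector `â`. -/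
def L2 (A : VonNeumannAlgebra H) (ξ : H) : Submodule ℂ H :=
  (A.toSubalgebra.toSubmodule.map (ContinuousLinearMap.apply ℂ H ξ).toLinearMap).topologicalClosure

instance (A : VonNeumannAlgebra H) (ξ : H) : CompleteSpace (A.L2 ξ) :=
  (Submodule.isClosed_topologicalClosure _).completeSpace_coe

theorem apply_mem_L2 (A : VonNeumannAlgebra H) (ξ : H) {a : H →L[ℂ] H} (ha : a ∈ A) {η : H}
    (hη : η ∈ A.L2 ξ) : a η ∈ A.L2 ξ := by
  have h := map_mem_closure (t := ((A.toSubalgebra.toSubmodule.map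
    (ContinuousLinearMap.apply ℂ H ξ).toLinearMap : Submodule ℂ H) : Set H)) a.continuous hη ?_
  · exact h
  · rintro _ ⟨b, hb, rfl⟩
    exact ⟨a * b, mul_mem (S := VonNeumannAlgebra H) (s := A) ha hb, rfl⟩

/-- The action of `a ∈ A` on `L²(A, τ)` by left multiplication. -/
def leftMul (A : VonNeumannAlgebra H) (ξ : H) (a : A) : A.L2 ξ →L[ℂ] A.L2 ξ :=
  ((a : H →L[ℂ] H).comp (A.L2 ξ).subtypeL).codRestrict (A.L2 ξ)
    fun η => A.apply_mem_L2 ξ a.2 η.2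

/-- Amenability of a finite von Neumann algebra `A`, for a unit vector `ξ` whose vector state
`τ(a) = ⟨a ξ, ξ⟩` is a faithful trace on `A`: there is a hypertrace, that is, a state `φ` on
`B(L²(A, τ))` with `φ(a T) = φ(T a)` for all `a ∈ A` and `T ∈ B(L²(A, τ))`, and whose restriction
to `A` is `τ`. -/
def IsAmenable (A : VonNeumannAlgebra H) (ξ : H) : Prop :=
  ∃ φ : (A.L2 ξ →L[ℂ] A.L2 ξ) →ₗ[ℂ] ℂ,
    φ 1 = 1 ∧
    (∀ T, 0 ≤ φ (star T * T)) ∧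
    (∀ (a : A) (T : A.L2 ξ →L[ℂ] A.L2 ξ), φ (A.leftMul ξ a * T) = φ (T * A.leftMul ξ a)) ∧
    (∀ a : A, φ (A.leftMul ξ a) = inner ℂ ξ ((a : H →L[ℂ] H) ξ))

/-- `N` is maximal amenable in `M`: it is an amenable von Neumann subalgebra of `M`, and the only
amenable von Neumann algebra `A` with `N ⊆ A ⊆ M` is `N` itself. Here the vector state of `ξ` is
assumed to be a faithful trace on `M`. -/
def IsMaximalAmenable (N M : VonNeumannAlgebra H) (ξ : H) : Prop :=
  N ≤ M ∧ N.IsAmenable ξ ∧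
    ∀ A : VonNeumannAlgebra H, N ≤ A → A ≤ M → A.IsAmenable ξ → A = N

end VonNeumannAlgebra

/-! ## Group von Neumann algebras -/

section GroupVN

variable {Γ : Type*} [Group Γ]

/-- The left regular representation `(λ_g f)(x) = f (g⁻¹ x)` on `ℓ²(Γ)`. -/
def leftRegularIsometry (g : Γ) : ℓ²(Γ, ℂ) →ₗᵢ[ℂ] ℓ²(Γ, ℂ) where
  toFun f := ⟨fun x => f (g⁻¹ * x), by
    have hp : 0 < (2 : ENNReal).toReal := by norm_num
    have h := (memℓp_gen_iff hp).1 (lp.memℓp f)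
    exact (memℓp_gen_iff hp).2 ((Equiv.mulLeft g⁻¹).summable_iff.2 h)⟩
  map_add' f f' := by ext x; rfl
  map_smul' c f := by ext x; rfl
  norm_map' f := by
    have hp : 0 < (2 : ENNReal).toReal := by norm_num
    rw [lp.norm_eq_tsum_rpow hp, lp.norm_eq_tsum_rpow hp]
    congr 1
    exact (Equiv.mulLeft g⁻¹).tsum_eq fun x => ‖f x‖ ^ (2 : ENNReal).toReal

/-- The operator `λ_g` on `ℓ²(Γ)`. -/
def leftRegular (g : Γ) : ℓ²(Γ, ℂ) →L[ℂ] ℓ²(Γ, ℂ) :=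
  (leftRegularIsometry g).toContinuousLinearMap

theorem leftRegular_apply (g : Γ) (f : ℓ²(Γ, ℂ)) (x : Γ) : leftRegular g f x = f (g⁻¹ * x) := rfl

/-- For a subgroup `Λ` of `Γ`, the von Neumann algebra `LΛ` as a subalgebra of `LΓ ⊆ B(ℓ²(Γ))`,
generated by the operators `λ_g` with `g ∈ Λ`. The algebra `LΓ` is the case `Λ = ⊤`. -/
def groupVN (Λ : Subgroup Γ) : VonNeumannAlgebra ℓ²(Γ, ℂ) :=
  VonNeumannAlgebra.generatedBy (leftRegular '' (Λ : Set Γ))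

open Classical in
/-- The Dirac function at the identity. Its vector state is the canonical trace of `LΓ`. -/
def diracOne (Γ : Type*) [Group Γ] : ℓ²(Γ, ℂ) := lp.single 2 (1 : Γ) (1 : ℂ)

end GroupVN

/-! ## Upper triangular matrices and the homogeneous space `G/P` -/

/-- The subgroup of upper triangular matrices in `SL_n(R)`. -/
def upperTriangular (n : ℕ) (R : Type*) [CommRing R] :
    Subgroup (Matrix.SpecialLinearGroup (Fin n) R) where
  carrier := {g | ∀ i j : Fin n, j < i → g i j = 0}
  one_mem' := fun _ _ h => Matrix.blockTriangular_one (b := id) h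
  mul_mem' {a b} ha hb := fun i j h => by
    have ha' : (a : Matrix (Fin n) (Fin n) R).BlockTriangular id := fun i j h => ha i j h
    have hb' : (b : Matrix (Fin n) (Fin n) R).BlockTriangular id := fun i j h => hb i j h
    exact (ha'.mul hb') h
  inv_mem' {a} ha := fun i j h => by
    have ha' : (a : Matrix (Fin n) (Fin n) R).BlockTriangular id := fun i j h => ha i j h
    have e : ((a⁻¹ : Matrix.SpecialLinearGroup (Fin n) R) : Matrix (Fin n) (Fin n) R) =
        (a : Matrix (Fin n) (Fin n) R)⁻¹ := by
      rw [Matrix.SpecialLinearGroup.coe_inv, Matrix.inv_def, a.det_coe]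
      simp
    have : Invertible (a : Matrix (Fin n) (Fin n) R) :=
      Matrix.invertibleOfIsUnitDet _ (by rw [a.det_coe]; exact isUnit_one)
    have := Matrix.blockTriangular_inv_of_blockTriangular ha' h
    rw [← e] at this
    exact this

/-- The homogeneous space `G/P`, where `G = SL_n(ℝ)` and `P` is the subgroup of upper triangular
matrices. -/
def FlagSpace (n : ℕ) : Type :=
  Matrix.SpecialLinearGroup (Fin n) ℝ ⧸ upperTriangular n ℝ

namespace FlagSpace

variable (n : ℕ)

/-- The quotient topology. -/
instance : TopologicalSpace (FlagSpace n) :=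
  inferInstanceAs (TopologicalSpace
    (Matrix.SpecialLinearGroup (Fin n) ℝ ⧸ upperTriangular n ℝ))

instance : MeasurableSpace (FlagSpace n) := borel _

instance : BorelSpace (FlagSpace n) := ⟨rfl⟩

/-- The action of `SL_n(ℝ)` by left multiplication on cosets. -/
instance : MulAction (Matrix.SpecialLinearGroup (Fin n) ℝ) (FlagSpace n) :=
  inferInstanceAs (MulAction (Matrix.SpecialLinearGroup (Fin n) ℝ)
    (Matrix.SpecialLinearGroup (Fin n) ℝ ⧸ upperTriangular n ℝ))

/-- The restriction of the action of `SL_n(ℝ)` to `SL_n(ℤ)`. -/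
instance : MulAction (Matrix.SpecialLinearGroup (Fin n) ℤ) (FlagSpace n) :=
  MulAction.compHom (FlagSpace n) (Matrix.SpecialLinearGroup.map (Int.castRingHom ℝ))

end FlagSpace

end

/-! Everything rests on one dynamical fact: the only `Λ`-invariant probability measure on `G/P` is
the Dirac mass at the base point (`FlagSpace.ae_eq_base`), and the stabilizer of the base point in
`Γ` is `Λ`. For the fact, let `j < i` and suppose that the first columns, up to but excluding `j`,
are already upper triangular almost everywhere. Then `g_jj / g_ij` is a well defined function on
cosets, with values in `ℝ ∪ {∞}`, and `1 + E_ji ∈ Λ` translates it by `1`. A finite measure on the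
line invariant under this translation is zero, so the ratio is almost surely `∞`, that is, `g_ij =
0`. Singularity follows at once, since `g ∉ Λ` moves the base point. Compactness of `G/P` is
Gram-Schmidt, and `Λ` is amenable because it is solvable.

For maximality, let `A` be amenable with `LΛ ⊆ A ⊆ LΓ`. Compression to `L²(A)` turns a hypertrace of
`A` into an `A`-central state `φ` on `B(ℓ²Γ)` that is still the trace on `LΓ`
(`exists_central_state`); this needs the conditional expectation of `LΓ` onto `A`. Let `C(G/P)` act
on `ℓ²Γ` through the orbit of the base point `x`. On it `φ` is a `Λ`-invariant state, hence
evaluation at `x` (`state_orbitFun_eq`). For `a ∈ A` and `g ∉ Λ` choose `f` with `f(x) = 1` and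
`f(g⁻¹x) = 0`. By Cauchy-Schwarz `f` acts as `1` under `φ`, while moving it past `λ_g⁻¹`, and past
`a` by centrality, yields a function that vanishes at `x`. So `φ(λ_g⁻¹ a) = 0`: the Fourier
coefficient of `a` at `g` vanishes, and `a ∈ LΛ` (`le_groupVN_of_isAmenable`). Amenability of `LΛ`
itself comes from averaging diagonal matrix coefficients with an invariant mean.

For the center, let `z = 1 + E_1n`. The diagonal entries of elements of `Λ` are `±1`, so conjugation
sends `z` to `z` or `z⁻¹`, and `λ_z + λ_z⁻¹` is central in `LΛ`. It would be scalar on a minimal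
projection of the center, but it has no eigenvectors: on each coset of `⟨z⟩` an eigenvector solves a
two-sided linear recurrence without nonzero solutions tending to `0`. -/

noncomputable section

open Filter Topology

/-! ## Means and amenable groups -/

section Means

variable {α β : Type*}

/-- Composition of bounded functions with a map of the index sets. -/
def lpComp (φ : α → β) : lp (fun _ : β => ℝ) ⊤ →ₗ[ℝ] lp (fun _ : α => ℝ) ⊤ where
  toFun f := ⟨fun x => f (φ x), memℓp_infty <| by
    obtain ⟨C, hC⟩ := memℓp_infty_iff.1 (lp.memℓp f)
    exact ⟨C, by rintro _ ⟨x, rfl⟩; exact hC ⟨φ x, rfl⟩⟩⟩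
  map_add' _ _ := rfl
  map_smul' _ _ := rfl

@[simp]
theorem lpComp_apply (φ : α → β) (f : lp (fun _ : β => ℝ) ⊤) (x : α) : lpComp φ f x = f (φ x) := rfl

/-- A mean on a set `α`: a positive unital functional on `ℓ^∞(α, ℝ)`. -/
def IsMean (m : lp (fun _ : α => ℝ) ⊤ →ₗ[ℝ] ℝ) : Prop :=
  m 1 = 1 ∧ ∀ f : lp (fun _ : α => ℝ) ⊤, (∀ x, 0 ≤ f x) → 0 ≤ m f

theorem IsMean.abs_le {m : lp (fun _ : α => ℝ) ⊤ →ₗ[ℝ] ℝ} (hm : IsMean m)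
    {f : lp (fun _ : α => ℝ) ⊤} {C : ℝ} (hf : ∀ x, |f x| ≤ C) : |m f| ≤ C := by
  have h1 := hm.2 (C • 1 - f) fun x => by
    have := (_root_.abs_le.1 (hf x)).2
    simp only [lp.coeFn_sub, lp.coeFn_smul, lp.infty_coeFn_one, Pi.sub_apply, Pi.smul_apply,
      Pi.one_apply, smul_eq_mul, mul_one]
    linarith
  have h2 := hm.2 (C • 1 + f) fun x => by
    have := (_root_.abs_le.1 (hf x)).1
    simp only [lp.coeFn_add, lp.coeFn_smul, lp.infty_coeFn_one, Pi.add_apply, Pi.smul_apply,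
      Pi.one_apply, smul_eq_mul, mul_one]
    linarith
  rw [map_sub, map_smul, hm.1, smul_eq_mul] at h1
  rw [map_add, map_smul, hm.1, smul_eq_mul] at h2
  exact _root_.abs_le.2 ⟨by linarith, by linarith⟩

theorem IsMean.abs_le_norm {m : lp (fun _ : α => ℝ) ⊤ →ₗ[ℝ] ℝ} (hm : IsMean m)
    (f : lp (fun _ : α => ℝ) ⊤) : |m f| ≤ ‖f‖ :=
  hm.abs_le fun x => lp.norm_apply_le_norm ENNReal.top_ne_zero f x

/-- Ultralimits of means. -/
theorem IsMean.exists_limit {ι : Type*} (U : Ultrafilter ι)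
    (m : ι → lp (fun _ : α => ℝ) ⊤ →ₗ[ℝ] ℝ) (hm : ∀ i, IsMean (m i)) :
    ∃ m' : lp (fun _ : α => ℝ) ⊤ →ₗ[ℝ] ℝ, IsMean m' ∧
      ∀ f, Tendsto (fun i => m i f) U (𝓝 (m' f)) := by
  have key : ∀ f : lp (fun _ : α => ℝ) ⊤, ∃ L, Tendsto (fun i => m i f) U (𝓝 L) := fun f => by
    obtain ⟨L, -, hL⟩ := (isCompact_Icc (a := -‖f‖) (b := ‖f‖)).ultrafilter_le_nhds
      (U.map fun i => m i f) (by
        rw [le_principal_iff]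
        exact mem_map.2 (univ_mem' fun i => _root_.abs_le.1 ((hm i).abs_le_norm f)))
    exact ⟨L, hL⟩
  choose L hL using key
  refine ⟨⟨⟨L, fun f g => ?_⟩, fun c f => ?_⟩, ⟨?_, fun f hf => ?_⟩, hL⟩
  · refine tendsto_nhds_unique (hL (f + g)) ?_
    simpa using (hL f).add (hL g)
  · refine tendsto_nhds_unique (hL (c • f)) ?_
    simpa using (hL f).const_mul c
  · refine tendsto_nhds_unique (hL 1) ?_
    simp [(hm _).1]
  · exact ge_of_tendsto (hL f) (Eventually.of_forall fun i => (hm i).2 f hf)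

end Means

section Amenable

variable {G : Type*} [Group G]

/-- The left translation `f ↦ (x ↦ f (g⁻¹ x))`. -/
abbrev lpTranslate (g : G) : lp (fun _ : G => ℝ) ⊤ →ₗ[ℝ] lp (fun _ : G => ℝ) ⊤ :=
  lpComp fun x => g⁻¹ * x

theorem isAmenableGroup_iff : IsAmenableGroup G ↔
    ∃ m : lp (fun _ : G => ℝ) ⊤ →ₗ[ℝ] ℝ, IsMean m ∧ ∀ g f, m (lpTranslate g f) = m f := by
  constructor
  · rintro ⟨m, h1, h2, h3⟩
    exact ⟨m, ⟨h1, h2⟩, fun g f => h3 g f _ fun x => rfl⟩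
  · rintro ⟨m, h, h3⟩
    refine ⟨m, h.1, h.2, fun g f f' hf => ?_⟩
    rw [← h3 g f]
    congr 1
    ext x
    exact hf x

/-- Cesàro averages of `m` along the powers of `g` become `g`-invariant in an ultralimit. Since `g`
is central, averaging preserves every invariance that `m` already has. -/
theorem IsMean.exists_invariant {m : lp (fun _ : G => ℝ) ⊤ →ₗ[ℝ] ℝ} (hm : IsMean m) (g : G)
    (hcomm : ∀ h : G, h * g = g * h) :
    ∃ m' : lp (fun _ : G => ℝ) ⊤ →ₗ[ℝ] ℝ, IsMean m' ∧ (∀ f, m' (lpTranslate g f) = m' f) ∧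
      ∀ h : G, (∀ f, m (lpTranslate h f) = m f) → ∀ f, m' (lpTranslate h f) = m' f := by
  let T : ℕ → lp (fun _ : G => ℝ) ⊤ →ₗ[ℝ] ℝ := fun k => m ∘ₗ lpTranslate (g ^ k)
  let A : ℕ → lp (fun _ : G => ℝ) ⊤ →ₗ[ℝ] ℝ := fun n =>
    ((n + 1 : ℝ)⁻¹) • ∑ k ∈ Finset.range (n + 1), T k
  have hT : ∀ k, IsMean (T k) := fun k => by
    refine ⟨?_, fun f hf => hm.2 _ fun x => hf _⟩
    rw [← hm.1]; rfl
  have hAapp : ∀ n f, A n f = (n + 1 : ℝ)⁻¹ * ∑ k ∈ Finset.range (n + 1), T k f := fun n f => by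
    simp [A]
  have hA : ∀ n, IsMean (A n) := fun n => by
    have hpos : (0 : ℝ) < n + 1 := by positivity
    refine ⟨?_, fun f hf => ?_⟩
    · rw [hAapp, Finset.sum_congr rfl fun k _ => (hT k).1]
      simp [hpos.ne']
    · rw [hAapp]
      exact mul_nonneg (by positivity) (Finset.sum_nonneg fun k _ => (hT k).2 f hf)
  obtain ⟨m', hm', hlim⟩ := IsMean.exists_limit (Ultrafilter.of (atTop : Filter ℕ)) A hA
  refine ⟨m', hm', fun f => ?_, fun h hh f => ?_⟩
  · have h0 : Tendsto (fun n => A n (lpTranslate g f) - A n f) (Ultrafilter.of (atTop : Filter ℕ))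
        (𝓝 0) := by
      refine Tendsto.mono_left ?_ (Ultrafilter.of_le atTop)
      -- The sum telescopes to two terms, each of size at most `‖f‖`.
      have hb : ∀ n, |A n (lpTranslate g f) - A n f| ≤
          (2 * ‖f‖) * (1 / ((n : ℝ) + 1)) := fun n => by
        have hpos : (0 : ℝ) < n + 1 := by positivity
        have hs : ∀ k, T k (lpTranslate g f) = T (k + 1) f := fun k => by
          change m _ = m _
          congr 1
          ext x
          simp only [lpComp_apply]
          rw [pow_succ, mul_inv_rev, mul_assoc]
        rw [hAapp, hAapp, ← mul_sub, ← Finset.sum_sub_distrib]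
        simp only [hs]
        rw [Finset.sum_range_sub (fun k => T k f), abs_mul, abs_of_pos (inv_pos.2 hpos),
          mul_comm, one_div]
        gcongr
        have h1 := (hT (n + 1)).abs_le_norm f
        have h2 := (hT 0).abs_le_norm f
        have := abs_sub (T (n + 1) f) (T 0 f)
        linarith
      refine squeeze_zero_norm hb ?_
      simpa using tendsto_one_div_add_atTop_nhds_zero_nat.const_mul (2 * ‖f‖)
    have := tendsto_nhds_unique ((hlim (lpTranslate g f)).sub (hlim f)) h0
    linarith
  · refine tendsto_nhds_unique (hlim _) ?_
    convert hlim f using 2 with n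
    rw [hAapp, hAapp]
    congr 1
    refine Finset.sum_congr rfl fun k _ => ?_
    change m _ = m _
    rw [← hh (lpTranslate (g ^ k) f)]
    congr 1
    ext x
    simp only [lpComp_apply]
    have hc : Commute h (g ^ k) := Commute.pow_right (hcomm h) k
    have : h⁻¹ * (g ^ k)⁻¹ = (g ^ k)⁻¹ * h⁻¹ := (hc.inv_inv).eq
    rw [← mul_assoc, this, mul_assoc]

/-- Invariance is gained one element at a time on finite sets, then for all elements by an
ultralimit along the directed set of finite subsets. -/
theorem isAmenableGroup_of_comm (hcomm : ∀ a b : G, a * b = b * a) : IsAmenableGroup G := by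
  classical
  have key : ∀ F : Finset G, ∃ m : lp (fun _ : G => ℝ) ⊤ →ₗ[ℝ] ℝ, IsMean m ∧
      ∀ g ∈ F, ∀ f, m (lpTranslate g f) = m f := fun F => by
    induction F using Finset.induction_on with
    | empty =>
      exact ⟨⟨⟨fun f => f 1, fun f g => rfl⟩, fun c f => rfl⟩, ⟨rfl, fun f hf => hf 1⟩, by simp⟩
    | insert a F _ ih =>
      obtain ⟨m, hm, hF⟩ := ih
      obtain ⟨m', hm', ha, hF'⟩ := hm.exists_invariant a fun h => hcomm h a
      refine ⟨m', hm', fun g hg => ?_⟩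
      rcases Finset.mem_insert.1 hg with rfl | hg
      · exact ha
      · exact hF' g (hF g hg)
  choose m hm hinv using key
  obtain ⟨m', hm', hlim⟩ := IsMean.exists_limit (Ultrafilter.of atTop) m hm
  refine isAmenableGroup_iff.2 ⟨m', hm', fun g f => tendsto_nhds_unique (hlim _) ?_⟩
  refine (hlim f).congr' ?_
  refine Ultrafilter.of_le atTop ?_
  filter_upwards [eventually_ge_atTop ({g} : Finset G)] with F hF
  exact (hinv F g (hF (Finset.mem_singleton_self g)) f).symm

/-- Average over each coset `gN` with the mean of `N`, then over `G ⧸ N`. -/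
theorem isAmenableGroup_of_normal (N : Subgroup G) [N.Normal] (hN : IsAmenableGroup N)
    (hQ : IsAmenableGroup (G ⧸ N)) : IsAmenableGroup G := by
  obtain ⟨mN, hmN, hinvN⟩ := isAmenableGroup_iff.1 hN
  obtain ⟨mQ, hmQ, hinvQ⟩ := isAmenableGroup_iff.1 hQ
  let E : G → lp (fun _ : G => ℝ) ⊤ → ℝ := fun g f => mN (lpComp (fun n : N => g * n) f)
  -- The average over a coset is independent of the representative, by invariance of the mean of
  -- `N`.
  have hE : ∀ (g : G) (n : N) f, E (g * n) f = E g f := fun g n f => by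
    change mN _ = mN _
    rw [← hinvN n⁻¹ (lpComp (fun n : N => g * n) f)]
    congr 1
    ext x
    simp [mul_assoc]
  let F : lp (fun _ : G => ℝ) ⊤ →ₗ[ℝ] lp (fun _ : G ⧸ N => ℝ) ⊤ :=
    { toFun := fun f => ⟨fun q => E q.out f, memℓp_infty ⟨‖f‖, by
        rintro _ ⟨q, rfl⟩
        exact hmN.abs_le fun x => lp.norm_apply_le_norm ENNReal.top_ne_zero f _⟩⟩
      map_add' := fun f g => by
        ext q
        change mN _ = mN _ + mN _
        rw [map_add, map_add]
      map_smul' := fun c f => by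
        ext q
        change mN _ = c * mN _
        rw [map_smul, map_smul, smul_eq_mul] }
  have hF : ∀ f (g : G), F f (g : G ⧸ N) = E g f := fun f g => by
    obtain ⟨n, hn⟩ := QuotientGroup.mk_out_eq_mul N g
    change E _ f = _
    rw [hn, hE]
  refine isAmenableGroup_iff.2 ⟨mQ ∘ₗ F, ⟨?_, fun f hf => ?_⟩, fun g f => ?_⟩
  · rw [← hmQ.1]
    change mQ _ = _
    congr 1
    ext q
    exact hmN.1
  · exact hmQ.2 _ fun q => hmN.2 _ fun n => hf _
  · change mQ _ = mQ _
    rw [← hinvQ g (F f)]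
    congr 1
    ext q
    induction q using QuotientGroup.induction_on with
    | H x =>
      rw [hF, lpComp_apply, ← QuotientGroup.mk_inv, ← QuotientGroup.mk_mul, hF]
      change mN _ = mN _
      congr 1
      ext n
      simp [mul_assoc]

theorem IsAmenableGroup.of_mulEquiv {H : Type*} [Group H] (e : G ≃* H) (hG : IsAmenableGroup G) :
    IsAmenableGroup H := by
  obtain ⟨m, hm, hinv⟩ := isAmenableGroup_iff.1 hG
  refine isAmenableGroup_iff.2 ⟨m ∘ₗ lpComp e, ⟨hm.1, fun f hf => hm.2 _ fun x => hf _⟩,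
    fun g f => ?_⟩
  change m _ = m _
  rw [← hinv (e.symm g) (lpComp e f)]
  congr 1
  ext x
  simp

/-- If `[H, H] ≤ K ≤ H` and `K` is amenable, then so is `H`. -/
theorem IsAmenableGroup.of_commutator_le {H K : Subgroup G} (hKH : K ≤ H)
    (hcomm : ∀ a ∈ H, ∀ b ∈ H, a * b * a⁻¹ * b⁻¹ ∈ K) (hK : IsAmenableGroup K) :
    IsAmenableGroup H := by
  have hnorm : (K.subgroupOf H).Normal := ⟨fun k hk h => by
    rw [Subgroup.mem_subgroupOf] at hk ⊢
    have h1 := K.mul_mem (hcomm h h.2 k k.2) hk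
    simpa using h1⟩
  refine isAmenableGroup_of_normal (K.subgroupOf H)
    (hK.of_mulEquiv (Subgroup.subgroupOfEquivOfLe hKH).symm) ?_
  refine isAmenableGroup_of_comm fun a b => ?_
  induction a using QuotientGroup.induction_on with
  | H a =>
    induction b using QuotientGroup.induction_on with
    | H b =>
      rw [← QuotientGroup.mk_mul, ← QuotientGroup.mk_mul, eq_comm, QuotientGroup.eq,
        Subgroup.mem_subgroupOf]
      have := hcomm (a : G)⁻¹ (H.inv_mem a.2) (b : G)⁻¹ (H.inv_mem b.2)
      simpa [mul_assoc] using this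

end Amenable

/-! ### Upper triangular groups are solvable, hence amenable -/

section UpperTriangular

open Matrix

variable {n : ℕ} {R : Type*} [CommRing R]

/-- The matrices with nonzero entries only in positions `(i, j)` with `i + k ≤ j`. -/
def IsUpperBand (k : ℕ) (A : Matrix (Fin n) (Fin n) R) : Prop :=
  ∀ i j : Fin n, (j : ℕ) < i + k → A i j = 0

theorem IsUpperBand.mul {k l : ℕ} {A B : Matrix (Fin n) (Fin n) R} (hA : IsUpperBand k A)
    (hB : IsUpperBand l B) : IsUpperBand (k + l) (A * B) := fun i j h => by
  rw [Matrix.mul_apply]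
  refine Finset.sum_eq_zero fun x _ => ?_
  by_cases hx : (x : ℕ) < i + k
  · rw [hA i x hx, zero_mul]
  · rw [hB x j (by omega), mul_zero]

theorem IsUpperBand.mono {k l : ℕ} (hkl : k ≤ l) {A : Matrix (Fin n) (Fin n) R}
    (hA : IsUpperBand l A) : IsUpperBand k A := fun i j h => hA i j (by omega)

theorem IsUpperBand.add {k : ℕ} {A B : Matrix (Fin n) (Fin n) R} (hA : IsUpperBand k A)
    (hB : IsUpperBand k B) : IsUpperBand k (A + B) := fun i j h => by
  rw [Matrix.add_apply, hA i j h, hB i j h, add_zero]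

theorem IsUpperBand.neg {k : ℕ} {A : Matrix (Fin n) (Fin n) R} (hA : IsUpperBand k A) :
    IsUpperBand k (-A) := fun i j h => by
  rw [Matrix.neg_apply, hA i j h, neg_zero]

/-- The diagonal entries of upper triangular matrices commute. -/
theorem IsUpperBand.commutator {k : ℕ} {A B : Matrix (Fin n) (Fin n) R} (hA : IsUpperBand k A)
    (hB : IsUpperBand k B) : IsUpperBand (k + 1) (A * B - B * A) := by
  rcases Nat.eq_zero_or_pos k with rfl | hk
  -- For `k = 0` the degree is gained because the diagonals commute; for `k ≥ 1` both products
  -- already lie in degree `2k ≥ k + 1`.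
  · have hdiag : ∀ {A B : Matrix (Fin n) (Fin n) R}, IsUpperBand 0 A → IsUpperBand 0 B → ∀ i,
        (A * B) i i = A i i * B i i := fun {A B} hA hB i => by
      rw [Matrix.mul_apply]
      refine Finset.sum_eq_single i (fun x _ hx => ?_) (by simp)
      by_cases h : (x : ℕ) < i
      · rw [hA i x h, zero_mul]
      · rw [hB x i (by have := Fin.val_ne_of_ne hx; omega), mul_zero]
    intro i j hij
    rw [Matrix.sub_apply]
    rcases Nat.lt_or_ge j i with h | h
    · rw [(hA.mul hB) i j h, (hB.mul hA) i j h, sub_zero]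
    · obtain rfl : i = j := Fin.ext (by omega)
      rw [hdiag hA hB, hdiag hB hA, mul_comm, sub_self]
  · rw [sub_eq_add_neg]
    exact ((hA.mul hB).mono (by omega)).add (((hB.mul hA).mono (by omega)).neg)

theorem mem_upperTriangular_iff {g : SpecialLinearGroup (Fin n) R} :
    g ∈ upperTriangular n R ↔ IsUpperBand 0 (g : Matrix (Fin n) (Fin n) R) := Iff.rfl

theorem isUpperBand_zero_one : IsUpperBand 0 (1 : Matrix (Fin n) (Fin n) R) :=
  mem_upperTriangular_iff.1 (upperTriangular n R).one_mem

/-- The upper triangular matrices `g` such that `g - 1` vanishes below the `k`-th superdiagonal. -/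
def upperUnitriangular (n : ℕ) (R : Type*) [CommRing R] (k : ℕ) :
    Subgroup (SpecialLinearGroup (Fin n) R) where
  carrier := {g | IsUpperBand k ((g : Matrix (Fin n) (Fin n) R) - 1)}
  one_mem' := fun i j _ => by simp
  mul_mem' {a b} ha hb := by
    have hb0 : IsUpperBand 0 (b : Matrix (Fin n) (Fin n) R) := by
      simpa using (hb.mono (Nat.zero_le k)).add isUpperBand_zero_one
    have h := (ha.mul hb0).add hb
    have e : ((a : Matrix (Fin n) (Fin n) R) - 1) * b + (b - 1) =
      ((a * b : SpecialLinearGroup (Fin n) R) : Matrix (Fin n) (Fin n) R) - 1 := by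
      rw [Matrix.SpecialLinearGroup.coe_mul]; noncomm_ring
    rw [e] at h
    exact h
  inv_mem' {a} ha := by
    have ha0 : IsUpperBand 0 (a : Matrix (Fin n) (Fin n) R) := by
      simpa using (ha.mono (Nat.zero_le k)).add isUpperBand_zero_one
    have hi0 := mem_upperTriangular_iff.1
      ((upperTriangular n R).inv_mem (mem_upperTriangular_iff.2 ha0))
    have h := (ha.mul hi0).neg
    have e : -(((a : Matrix (Fin n) (Fin n) R) - 1) * (a⁻¹ : SpecialLinearGroup (Fin n) R)) =
      ((a⁻¹ : SpecialLinearGroup (Fin n) R) : Matrix (Fin n) (Fin n) R) - 1 := by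
      rw [sub_mul, ← Matrix.SpecialLinearGroup.coe_mul, mul_inv_cancel,
        Matrix.SpecialLinearGroup.coe_one]
      noncomm_ring
    rw [e] at h
    exact h

theorem upperUnitriangular_zero : upperUnitriangular n R 0 = upperTriangular n R := by
  ext g
  rw [mem_upperTriangular_iff]
  change IsUpperBand 0 _ ↔ _
  constructor <;> intro h
  · simpa using h.add isUpperBand_zero_one
  · rw [sub_eq_add_neg]
    exact h.add isUpperBand_zero_one.neg

/-- This rests on the identity `aba⁻¹b⁻¹ - 1 = [a - 1, b - 1] a⁻¹b⁻¹`, where the bracket is the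
additive commutator. -/
theorem commutator_mem_upperUnitriangular (k : ℕ) {a b : SpecialLinearGroup (Fin n) R}
    (ha : a ∈ upperUnitriangular n R k) (hb : b ∈ upperUnitriangular n R k) :
    a * b * a⁻¹ * b⁻¹ ∈ upperUnitriangular n R (k + 1) := by
  have hle : upperUnitriangular n R k ≤ upperUnitriangular n R 0 :=
    fun g hg => IsUpperBand.mono (Nat.zero_le k) hg
  have hc := mem_upperTriangular_iff.1 <| upperUnitriangular_zero.le <|
    hle (mul_mem (inv_mem ha) (inv_mem hb))
  have h := (IsUpperBand.commutator ha hb).mul hc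
  have e : (((a : Matrix (Fin n) (Fin n) R) - 1) * (b - 1) - (b - 1) * (a - 1)) *
      ((a⁻¹ * b⁻¹ : SpecialLinearGroup (Fin n) R) : Matrix (Fin n) (Fin n) R) =
      ((a * b * a⁻¹ * b⁻¹ : SpecialLinearGroup (Fin n) R) : Matrix (Fin n) (Fin n) R) - 1 := by
    have e1 : ((a : Matrix (Fin n) (Fin n) R) - 1) * (b - 1) - (b - 1) * (a - 1) =
        ((a * b : SpecialLinearGroup (Fin n) R) : Matrix (Fin n) (Fin n) R) -
        ((b * a : SpecialLinearGroup (Fin n) R) : Matrix (Fin n) (Fin n) R) := by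
      rw [Matrix.SpecialLinearGroup.coe_mul, Matrix.SpecialLinearGroup.coe_mul]; noncomm_ring
    have e2 : a * b * (a⁻¹ * b⁻¹) = a * b * a⁻¹ * b⁻¹ := by simp only [mul_assoc]
    have e3 : b * a * (a⁻¹ * b⁻¹) = 1 := by simp
    rw [e1, sub_mul, ← Matrix.SpecialLinearGroup.coe_mul, ← Matrix.SpecialLinearGroup.coe_mul,
      e2, e3, Matrix.SpecialLinearGroup.coe_one]
  rw [e] at h
  exact h

theorem isAmenableGroup_upperTriangular (n : ℕ) (R : Type*) [CommRing R] :
    IsAmenableGroup (upperTriangular n R) := by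
  rw [← upperUnitriangular_zero]
  -- Descending induction on `k`, starting from the trivial group at `k = n`.
  have key : ∀ l k : ℕ, k + l = n → IsAmenableGroup (upperUnitriangular n R k) := fun l => by
    induction l with
    | zero =>
      rintro k rfl
      have h1 : ∀ g ∈ upperUnitriangular (k + 0) R k, g = 1 := fun g hg => by
        have h0 : (g : Matrix (Fin (k + 0)) (Fin (k + 0)) R) - 1 = 0 :=
          Matrix.ext fun i j => hg i j (by omega)
        exact Subtype.ext (sub_eq_zero.1 h0)
      refine isAmenableGroup_of_comm fun a b => Subtype.ext ?_
      change (a : SpecialLinearGroup (Fin (k + 0)) R) * b = b * a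
      rw [h1 a a.2, h1 b b.2]
    | succ l ih =>
      intro k hk
      exact IsAmenableGroup.of_commutator_le (fun g hg => IsUpperBand.mono (Nat.le_succ k) hg)
        (fun a ha b hb => commutator_mem_upperUnitriangular k ha hb) (ih (k + 1) (by omega))
  exact key n 0 (by omega)

end UpperTriangular

/-! ### The flag space and its `Λ`-invariant measures -/

namespace FlagSpace

open Matrix MeasureTheory

variable {n : ℕ}

/-- The quotient map `G → G/P`. -/
def mk (g : Matrix.SpecialLinearGroup (Fin n) ℝ) : FlagSpace n :=
  QuotientGroup.mk g

theorem mk_surjective : Function.Surjective (mk (n := n)) := QuotientGroup.mk_surjective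

theorem isOpenQuotientMap_mk : IsOpenQuotientMap (mk (n := n)) :=
  QuotientGroup.isOpenQuotientMap_mk

theorem mk_eq_mk {g h : Matrix.SpecialLinearGroup (Fin n) ℝ} :
    mk g = mk h ↔ g⁻¹ * h ∈ upperTriangular n ℝ := QuotientGroup.eq

theorem int_smul_mk (g : Matrix.SpecialLinearGroup (Fin n) ℤ)
    (h : Matrix.SpecialLinearGroup (Fin n) ℝ) :
    g • mk h = mk (Matrix.SpecialLinearGroup.map (Int.castRingHom ℝ) g * h) := rfl

theorem continuous_real_smul (g : Matrix.SpecialLinearGroup (Fin n) ℝ) :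
    Continuous fun x : FlagSpace n => g • x := by
  rw [isOpenQuotientMap_mk.isQuotientMap.continuous_iff]
  exact isOpenQuotientMap_mk.continuous.comp (continuous_const_mul g)

theorem continuous_int_smul (g : Matrix.SpecialLinearGroup (Fin n) ℤ) :
    Continuous fun x : FlagSpace n => g • x :=
  continuous_real_smul _

theorem continuous_entry (i j : Fin n) :
    Continuous fun g : Matrix.SpecialLinearGroup (Fin n) ℝ => g i j :=
  (continuous_apply_apply i j).comp continuous_subtype_val

theorem isClosed_upperTriangular :
    IsClosed (upperTriangular n ℝ : Set (Matrix.SpecialLinearGroup (Fin n) ℝ)) := by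
  have : (upperTriangular n ℝ : Set (Matrix.SpecialLinearGroup (Fin n) ℝ)) =
      ⋂ i, ⋂ j, ⋂ (_ : j < i), {g | g i j = 0} := by
    ext g
    simp only [Set.mem_iInter]
    rfl
  rw [this]
  exact isClosed_iInter fun i => isClosed_iInter fun j => isClosed_iInter fun _ =>
    isClosed_eq (continuous_entry i j) continuous_const

instance : T2Space (FlagSpace n) := by
  rw [t2Space_iff_of_isOpenQuotientMap isOpenQuotientMap_mk]
  simp only [mk_eq_mk]
  exact isClosed_upperTriangular.preimage (continuous_fst.inv.mul continuous_snd)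

theorem isCompact_orthogonal : IsCompact {k : Matrix.SpecialLinearGroup (Fin n) ℝ |
    (k : Matrix (Fin n) (Fin n) ℝ)ᵀ * k = 1} := by
  have hS : IsCompact {A : Matrix (Fin n) (Fin n) ℝ | Aᵀ * A = 1} := by
    have hbox : IsCompact (Set.pi Set.univ fun _ : Fin n => Set.pi Set.univ fun _ : Fin n =>
        Set.Icc (-1 : ℝ) 1) :=
      isCompact_univ_pi fun _ => isCompact_univ_pi fun _ => isCompact_Icc
    refine hbox.of_isClosed_subset
      (isClosed_eq (continuous_id.matrix_transpose.mul continuous_id) continuous_const) ?_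
    intro A hA i _ j _
    have hU : A ∈ Matrix.unitaryGroup (Fin n) ℝ := Matrix.mem_unitaryGroup_iff'.2 hA
    exact abs_le.1 (entry_norm_bound_of_unitary hU i j)
  exact Matrix.SpecialLinearGroup.isClosedEmbedding_val.isCompact_preimage hS

/-- Every coset of the upper triangular group contains a special orthogonal matrix. -/
theorem exists_orthogonal_mk_eq [NeZero n] (g : Matrix.SpecialLinearGroup (Fin n) ℝ) :
    ∃ k : Matrix.SpecialLinearGroup (Fin n) ℝ,
      (k : Matrix (Fin n) (Fin n) ℝ)ᵀ * k = 1 ∧ mk k = mk g := by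
  let f : Fin n → EuclideanSpace ℝ (Fin n) := fun j => WithLp.toLp 2 fun r => g r j
  have hfin : Module.finrank ℝ (EuclideanSpace ℝ (Fin n)) = Fintype.card (Fin n) := by simp
  let b := InnerProductSpace.gramSchmidtOrthonormalBasis hfin f
  let Q : Matrix (Fin n) (Fin n) ℝ := Matrix.of fun r j => b j r
  have hQ : Qᵀ * Q = 1 := by
    ext i j
    have := orthonormal_iff_ite.1 b.orthonormal i j
    rw [Matrix.mul_apply, Matrix.one_apply, ← this, PiLp.inner_apply]
    exact Finset.sum_congr rfl fun x _ => by simp [Q, mul_comm]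
  have hdet : Q.det * Q.det = 1 := by
    have := congrArg Matrix.det hQ
    rwa [Matrix.det_mul, Matrix.det_transpose, Matrix.det_one] at this
  -- The first column is multiplied by `det Q = ±1`, which makes the determinant `1` and keeps the
  -- columns orthonormal.
  let d : Fin n → ℝ := Function.update 1 0 Q.det
  have hd : Matrix.diagonal d * Matrix.diagonal d = 1 := by
    rw [Matrix.diagonal_mul_diagonal, ← Matrix.diagonal_one]
    congr 1
    ext i
    by_cases hi : i = 0
    · subst hi; simpa [d] using hdet
    · simp [d, hi]
  have hk : (Q * Matrix.diagonal d).det = 1 := by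
    rw [Matrix.det_mul, Matrix.det_diagonal, Finset.prod_update_of_mem (Finset.mem_univ _)]
    simpa using hdet
  have hkk : (Q * Matrix.diagonal d)ᵀ * (Q * Matrix.diagonal d) = 1 := by
    rw [Matrix.transpose_mul, Matrix.diagonal_transpose]
    calc Matrix.diagonal d * Qᵀ * (Q * Matrix.diagonal d)
        = Matrix.diagonal d * (Qᵀ * Q) * Matrix.diagonal d := by simp only [Matrix.mul_assoc]
      _ = 1 := by rw [hQ, Matrix.mul_one, hd]
  let k : Matrix.SpecialLinearGroup (Fin n) ℝ := ⟨Q * Matrix.diagonal d, hk⟩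
  refine ⟨k, hkk, mk_eq_mk.2 ?_⟩
  have hinv : ((k⁻¹ : Matrix.SpecialLinearGroup (Fin n) ℝ) : Matrix (Fin n) (Fin n) ℝ) =
      (Q * Matrix.diagonal d)ᵀ := by
    have h1 : ((k⁻¹ : Matrix.SpecialLinearGroup (Fin n) ℝ) : Matrix (Fin n) (Fin n) ℝ) *
        (Q * Matrix.diagonal d) = 1 := congrArg Subtype.val (inv_mul_cancel k)
    exact left_inv_eq_right_inv h1 (mul_eq_one_comm.1 hkk)
  intro i j hij
  change (((k⁻¹ : Matrix.SpecialLinearGroup (Fin n) ℝ) : Matrix (Fin n) (Fin n) ℝ) *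
    (g : Matrix (Fin n) (Fin n) ℝ)) i j = 0
  rw [hinv, Matrix.transpose_mul, Matrix.diagonal_transpose, Matrix.mul_assoc,
    Matrix.diagonal_mul, Matrix.mul_apply]
  -- Each column of `g` is orthogonal to all later Gram-Schmidt vectors.
  have := InnerProductSpace.gramSchmidtOrthonormalBasis_inv_triangular hfin f hij
  rw [PiLp.inner_apply] at this
  rw [mul_eq_zero]
  right
  rw [← this]
  exact Finset.sum_congr rfl fun x _ => by simp [Q, f, b, mul_comm]

theorem compactSpace [NeZero n] : CompactSpace (FlagSpace n) := by
  refine ⟨?_⟩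
  have : (Set.univ : Set (FlagSpace n)) = mk '' {k : Matrix.SpecialLinearGroup (Fin n) ℝ |
      (k : Matrix (Fin n) (Fin n) ℝ)ᵀ * k = 1} := by
    refine (Set.eq_univ_of_forall fun x => ?_).symm
    obtain ⟨g, rfl⟩ := mk_surjective x
    exact exists_orthogonal_mk_eq g
  rw [this]
  exact isCompact_orthogonal.image isOpenQuotientMap_mk.continuous

/-! ### Invariant measures -/

/-- A closed `P`-invariant subset of `G`, as a subset of `G/P`. -/
def saturated (A : Set (Matrix.SpecialLinearGroup (Fin n) ℝ)) : Set (FlagSpace n) :=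
  {x | ∀ g, mk g = x → g ∈ A}

/-- A subset of `G` that is stable under right multiplication by upper triangular matrices. -/
def IsSaturated (A : Set (Matrix.SpecialLinearGroup (Fin n) ℝ)) : Prop :=
  ∀ g ∈ A, ∀ p ∈ upperTriangular n ℝ, g * p ∈ A

theorem IsSaturated.mk_mem {A : Set (Matrix.SpecialLinearGroup (Fin n) ℝ)} (hA : IsSaturated A)
    {g : Matrix.SpecialLinearGroup (Fin n) ℝ} : mk g ∈ saturated A ↔ g ∈ A := by
  refine ⟨fun h => h g rfl, fun h g' hg' => ?_⟩
  have := hA g h _ (mk_eq_mk.1 hg'.symm)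
  rwa [mul_inv_cancel_left] at this

theorem IsSaturated.isClosed {A : Set (Matrix.SpecialLinearGroup (Fin n) ℝ)} (hA : IsSaturated A)
    (hc : IsClosed A) : IsClosed (saturated A) := by
  rw [← isOpenQuotientMap_mk.isQuotientMap.isClosed_preimage]
  convert hc using 1
  ext g
  exact hA.mk_mem

/-- The matrices whose first `j` columns are upper triangular. -/
def upperCols (n j : ℕ) : Set (Matrix.SpecialLinearGroup (Fin n) ℝ) :=
  {g | ∀ i k : Fin n, (k : ℕ) < j → k < i → g i k = 0}

theorem isClosed_upperCols (j : ℕ) : IsClosed (upperCols n j) := by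
  have : upperCols n j = ⋂ i, ⋂ k : Fin n, ⋂ (_ : (k : ℕ) < j), ⋂ (_ : k < i),
      {g | g i k = 0} := by
    ext g
    simp only [Set.mem_iInter]
    rfl
  rw [this]
  exact isClosed_iInter fun i => isClosed_iInter fun k => isClosed_iInter fun _ =>
    isClosed_iInter fun _ => isClosed_eq (continuous_entry i k) continuous_const

/-- On and below the diagonal, in columns up to `j`, right multiplication by `p ∈ P` only rescales
the columns. Hence ratios within column `j` are functions on `G/P`. -/
theorem mul_apply_of_upperCols {j : Fin n} {g p : Matrix.SpecialLinearGroup (Fin n) ℝ}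
    (hg : g ∈ upperCols n j) (hp : p ∈ upperTriangular n ℝ) {i k : Fin n} (hk : k ≤ j)
    (hi : k ≤ i) : (g * p) i k = g i k * p k k := by
  change ((g : Matrix (Fin n) (Fin n) ℝ) * (p : Matrix (Fin n) (Fin n) ℝ)) i k = _
  rw [Matrix.mul_apply]
  refine Finset.sum_eq_single k (fun x _ hx => ?_) (by simp)
  rcases lt_or_gt_of_ne hx with h | h
  · rw [hg i x (lt_of_lt_of_le h hk) (lt_of_lt_of_le h hi), zero_mul]
  · rw [hp x k h, mul_zero]

theorem isSaturated_upperCols (j : Fin n) : IsSaturated (upperCols n j) :=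
  fun g hg p hp i k hk hki => by
    rw [mul_apply_of_upperCols hg hp (Fin.le_def.2 hk.le) hki.le, hg i k hk hki, zero_mul]

/-- The matrices in `upperCols n j` with `m g_ij² ≤ g_jj g_ij`. -/
def ratioSet (i j : Fin n) (m : ℤ) : Set (Matrix.SpecialLinearGroup (Fin n) ℝ) :=
  {g | g ∈ upperCols n j ∧ m * (g i j * g i j) ≤ g j j * g i j}

theorem isClosed_ratioSet (i j : Fin n) (m : ℤ) : IsClosed (ratioSet i j m) :=
  (isClosed_upperCols j).inter (isClosed_le
    (continuous_const.mul ((continuous_entry i j).mul (continuous_entry i j)))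
    ((continuous_entry j j).mul (continuous_entry i j)))

/-- Both sides of the inequality scale by `p_jj² ≥ 0`. The quadratic form of `g_jj / g_ij ≥ m` needs
no case distinction on the sign of `g_ij` and admits `g_ij = 0` as the value `∞`. -/
theorem isSaturated_ratioSet {i j : Fin n} (hij : j < i) (m : ℤ) :
    IsSaturated (ratioSet i j m) := fun g hg p hp => by
  refine ⟨isSaturated_upperCols j g hg.1 p hp, ?_⟩
  rw [mul_apply_of_upperCols hg.1 hp le_rfl hij.le, mul_apply_of_upperCols hg.1 hp le_rfl le_rfl]
  have := mul_le_mul_of_nonneg_right hg.2 (mul_self_nonneg (p j j))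
  linarith

/-- The matrices in `upperCols n j` with `g_ij = 0`. -/
def zeroSet (i j : Fin n) : Set (Matrix.SpecialLinearGroup (Fin n) ℝ) :=
  {g | g ∈ upperCols n j ∧ g i j = 0}

theorem isSaturated_zeroSet {i j : Fin n} (hij : j < i) : IsSaturated (zeroSet i j) :=
  fun g hg p hp => by
    refine ⟨isSaturated_upperCols j g hg.1 p hp, ?_⟩
    rw [mul_apply_of_upperCols hg.1 hp le_rfl hij.le, hg.2, zero_mul]

/-- The elementary matrix `1 + E_ji` in `SL_n(ℤ)`. -/
def elementary {i j : Fin n} (hij : j ≠ i) : Matrix.SpecialLinearGroup (Fin n) ℤ :=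
  ⟨Matrix.transvection j i 1, Matrix.det_transvection_of_ne j i hij 1⟩

theorem elementary_mem {i j : Fin n} (hij : j < i) :
    elementary hij.ne ∈ upperTriangular n ℤ := fun a b hab => by
  change Matrix.transvection j i 1 a b = 0
  rw [Matrix.transvection, Matrix.add_apply, Matrix.one_apply_ne hab.ne', zero_add]
  refine Matrix.single_apply_of_ne _ _ _ _ _ ?_
  rintro ⟨rfl, rfl⟩
  exact lt_asymm hab hij

theorem elementary_mul_apply {i j : Fin n} (hij : j ≠ i)
    (g : Matrix.SpecialLinearGroup (Fin n) ℝ) (a b : Fin n) :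
    (Matrix.SpecialLinearGroup.map (Int.castRingHom ℝ) (elementary hij) * g) a b =
      g a b + if a = j then g i b else 0 := by
  have h : ((Matrix.SpecialLinearGroup.map (Int.castRingHom ℝ) (elementary hij) :
      Matrix.SpecialLinearGroup (Fin n) ℝ) : Matrix (Fin n) (Fin n) ℝ) =
      Matrix.transvection j i 1 := by
    ext a b
    change ((Matrix.transvection j i (1 : ℤ) a b : ℤ) : ℝ) = _
    simp only [Matrix.transvection, Matrix.add_apply, Matrix.one_apply, Matrix.single_apply]
    push_cast
    rfl
  change (((Matrix.SpecialLinearGroup.map (Int.castRingHom ℝ) (elementary hij) :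
      Matrix.SpecialLinearGroup (Fin n) ℝ) : Matrix (Fin n) (Fin n) ℝ) *
      (g : Matrix (Fin n) (Fin n) ℝ)) a b = _
  rw [h]
  split_ifs with ha
  · subst ha
    rw [Matrix.transvection_mul_apply_same, one_mul]
  · rw [Matrix.transvection_mul_apply_of_ne _ _ _ _ ha, add_zero]

/-- Adding row `i` to row `j` replaces `g_jj / g_ij` by `g_jj / g_ij + 1`. -/
theorem elementary_smul_mem {i j : Fin n} (hij : j < i) (m : ℤ) (x : FlagSpace n) :
    elementary hij.ne • x ∈ saturated (ratioSet i j (m + 1)) ↔ x ∈ saturated (ratioSet i j m) := by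
  obtain ⟨g, rfl⟩ := mk_surjective x
  rw [int_smul_mk, (isSaturated_ratioSet hij _).mk_mem, (isSaturated_ratioSet hij _).mk_mem]
  have hcols : Matrix.SpecialLinearGroup.map (Int.castRingHom ℝ) (elementary hij.ne) * g ∈
      upperCols n j ↔ g ∈ upperCols n j := by
    constructor
    · intro h a k hk hka
      have h1 := h a k hk hka
      have h2 := h i k hk (lt_trans (Fin.lt_def.2 hk) hij)
      rw [elementary_mul_apply, if_neg hij.ne', add_zero] at h2
      rwa [elementary_mul_apply, h2, ite_self, add_zero] at h1
    · intro h a k hk hka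
      rw [elementary_mul_apply, h a k hk hka, h i k hk (lt_trans (Fin.lt_def.2 hk) hij), ite_self,
        add_zero]
  refine and_congr hcols ?_
  rw [elementary_mul_apply, elementary_mul_apply, if_pos rfl, if_neg hij.ne', add_zero]
  push_cast
  constructor <;> intro h <;> linarith

/-- The sets `g_jj / g_ij ≥ m` decrease in `m` and have equal measure, by invariance under `1 +
E_ji`. Their union over `m → -∞` is the whole of `upperCols`, their intersection over `m → ∞` is the
locus `g_ij = 0`, so continuity of the measure identifies the two. -/
theorem measure_zeroSet_eq (μ : Measure (FlagSpace n)) [IsFiniteMeasure μ]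
    (hμ : ∀ h ∈ upperTriangular n ℤ, μ.map (fun x => h • x) = μ) {i j : Fin n} (hij : j < i) :
    μ (saturated (zeroSet i j)) = μ (saturated (upperCols n j)) := by
  let C : ℤ → Set (FlagSpace n) := fun m => saturated (ratioSet i j m)
  have hCclosed : ∀ m, IsClosed (C m) := fun m =>
    (isSaturated_ratioSet hij m).isClosed (isClosed_ratioSet i j m)
  have hstep : ∀ m, μ (C (m + 1)) = μ (C m) := fun m => by
    conv_lhs => rw [← hμ _ (elementary_mem hij)]
    rw [Measure.map_apply (continuous_int_smul _).measurable (hCclosed _).measurableSet]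
    congr 1
    ext x
    exact elementary_smul_mem hij m x
  have hconst : ∀ m, μ (C m) = μ (C 0) := fun m => by
    induction m using Int.induction_on with
    | zero => rfl
    | succ k ih => rw [hstep, ih]
    | pred k ih => rw [← ih, ← hstep, sub_add_cancel]
  have hanti : Antitone C := fun m m' hm x hx => by
    obtain ⟨g, rfl⟩ := mk_surjective x
    rw [(isSaturated_ratioSet hij _).mk_mem] at hx ⊢
    refine ⟨hx.1, le_trans ?_ hx.2⟩
    have : (m : ℝ) ≤ m' := by exact_mod_cast hm
    exact mul_le_mul_of_nonneg_right this (mul_self_nonneg _)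
  have hUnion : ⋃ m : ℕ, C (-(m : ℤ)) = saturated (upperCols n j) := by
    ext x
    obtain ⟨g, rfl⟩ := mk_surjective x
    rw [Set.mem_iUnion, (isSaturated_upperCols j).mk_mem]
    simp only [C, (isSaturated_ratioSet hij _).mk_mem]
    refine ⟨fun ⟨m, hm⟩ => hm.1, fun h => ?_⟩
    by_cases h0 : g i j = 0
    · exact ⟨0, h, by rw [h0]; simp⟩
    · obtain ⟨m, hm⟩ := exists_nat_ge (-(g j j * g i j) / (g i j * g i j))
      refine ⟨m, h, ?_⟩
      rw [div_le_iff₀ (mul_self_pos.2 h0)] at hm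
      push_cast
      linarith
  have hInter : ⋂ m : ℕ, C m = saturated (zeroSet i j) := by
    ext x
    obtain ⟨g, rfl⟩ := mk_surjective x
    rw [Set.mem_iInter, (isSaturated_zeroSet hij).mk_mem]
    simp only [C, (isSaturated_ratioSet hij _).mk_mem]
    refine ⟨fun h => ⟨(h 0).1, ?_⟩, fun h m => ⟨h.1, by rw [h.2]; simp⟩⟩
    by_contra h0
    obtain ⟨m, hm⟩ := exists_nat_gt ((g j j * g i j) / (g i j * g i j))
    rw [div_lt_iff₀ (mul_self_pos.2 h0)] at hm
    have := (h m).2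
    push_cast at this
    linarith
  have h1 := tendsto_measure_iUnion_atTop (μ := μ) (s := fun m : ℕ => C (-(m : ℤ)))
    fun a b hab => hanti (by omega)
  have h2 := tendsto_measure_iInter_atTop (μ := μ) (s := fun m : ℕ => C m)
    (fun m => (hCclosed _).measurableSet.nullMeasurableSet)
    (fun a b hab => hanti (by exact_mod_cast hab)) ⟨0, measure_ne_top _ _⟩
  rw [hUnion] at h1
  rw [hInter] at h2
  simp only [Function.comp_def, hconst] at h1 h2
  exact (tendsto_nhds_unique h2 tendsto_const_nhds).trans
    (tendsto_nhds_unique tendsto_const_nhds h1)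

/-- An invariant measure is concentrated at the base point. -/
theorem ae_eq_base (μ : Measure (FlagSpace n)) [IsFiniteMeasure μ]
    (hμ : ∀ h ∈ upperTriangular n ℤ, μ.map (fun x => h • x) = μ) :
    ∀ᵐ x ∂μ, x = mk 1 := by
  -- Induction on the number of columns known to be upper triangular almost everywhere.
  have key : ∀ j : ℕ, j ≤ n → ∀ᵐ x ∂μ, x ∈ saturated (upperCols n j) := fun j => by
    induction j with
    | zero => exact fun _ => Eventually.of_forall fun x g _ i k hk => absurd hk (Nat.not_lt_zero _)
    | succ j ih =>
      intro hj
      let J : Fin n := ⟨j, hj⟩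
      have hJ : ∀ᵐ x ∂μ, x ∈ saturated (upperCols n (J : ℕ)) := ih (by omega)
      have hi : ∀ i : Fin n, ∀ᵐ x ∂μ, J < i → x ∈ saturated (zeroSet i J) := fun i => by
        by_cases hij : J < i
        · have hm : MeasurableSet (saturated (zeroSet i J)) :=
            ((isSaturated_zeroSet hij).isClosed ((isClosed_upperCols _).inter
              (isClosed_eq (continuous_entry i J) continuous_const))).measurableSet
          have hJm : MeasurableSet (saturated (upperCols n (J : ℕ))) :=
            ((isSaturated_upperCols J).isClosed (isClosed_upperCols _)).measurableSet
          have h0 : μ (saturated (zeroSet i J))ᶜ = 0 := by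
            rw [measure_compl hm (measure_ne_top _ _), measure_zeroSet_eq μ hμ hij,
              ← measure_compl hJm (measure_ne_top _ _)]
            exact hJ
          have h0' : ∀ᵐ x ∂μ, x ∈ saturated (zeroSet i J) := h0
          filter_upwards [h0'] with x hx _ using hx
        · exact Eventually.of_forall fun x h => absurd h hij
      filter_upwards [hJ, ae_all_iff.2 hi] with x hx hx' g hg a k hk hka
      rcases Nat.lt_succ_iff_lt_or_eq.1 hk with h | h
      · exact hx g hg a k h hka
      · obtain rfl : k = J := Fin.ext h
        exact (hx' a hka g hg).2
  filter_upwards [key n le_rfl] with x hx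
  obtain ⟨g, rfl⟩ := mk_surjective x
  refine (mk_eq_mk.2 ?_).symm
  rw [inv_one, one_mul]
  exact fun i k hk => hx g rfl i k k.2 hk

theorem int_smul_base_eq {g : Matrix.SpecialLinearGroup (Fin n) ℤ} :
    g • (mk 1 : FlagSpace n) = mk 1 ↔ g ∈ upperTriangular n ℤ := by
  rw [int_smul_mk, eq_comm, mk_eq_mk, inv_one, one_mul, mul_one]
  refine forall₃_congr fun i j _ => ?_
  change ((g i j : ℤ) : ℝ) = 0 ↔ _
  exact Int.cast_eq_zero

theorem isSingularSubgroup [NeZero n] :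
    IsSingularSubgroup (upperTriangular n ℤ) (FlagSpace n) where
  countable := by
    unfold Matrix.SpecialLinearGroup Matrix
    infer_instance
  amenable := isAmenableGroup_upperTriangular n ℤ
  compact := compactSpace
  t2 := inferInstance
  continuous_smul := continuous_int_smul
  mutuallySingular := fun μ hμ hinv g hg => by
    have h0 : μ {x | ¬x = mk 1} = 0 := ae_eq_base μ hinv
    -- The base point separates the measures: it carries `μ` and is null for `g · μ`, because `g`
    -- does not fix it.
    refine ⟨{mk 1}, (measurableSet_singleton _), ?_, h0⟩
    rw [Measure.map_apply (continuous_int_smul g).measurable (measurableSet_singleton _)]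
    refine measure_mono_null (fun x hx => ?_) h0
    rintro rfl
    exact hg (int_smul_base_eq.1 hx)

end FlagSpace

/-! ## Compressions and positive functionals -/

section Compression

variable {H : Type*} [NormedAddCommGroup H] [InnerProductSpace ℂ H]

theorem inner_apply_left [CompleteSpace H] (S : H →L[ℂ] H) (x y : H) :
    inner ℂ (S x) y = inner ℂ x (star S y) := by
  rw [ContinuousLinearMap.star_eq_adjoint, ContinuousLinearMap.adjoint_inner_right]

theorem inner_apply_right [CompleteSpace H] (S : H →L[ℂ] H) (x y : H) :
    inner ℂ x (S y) = inner ℂ (star S x) y := by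
  rw [ContinuousLinearMap.star_eq_adjoint, ContinuousLinearMap.adjoint_inner_left]

/-- A closed subspace that reduces `S` has a projection that commutes with `S`. -/
theorem Submodule.starProjection_apply_comm [CompleteSpace H] (K : Submodule ℂ H)
    [K.HasOrthogonalProjection]
    {S : H →L[ℂ] H} (h : ∀ v ∈ K, S v ∈ K) (h' : ∀ v ∈ K, star S v ∈ K) (v : H) :
    K.starProjection (S v) = S (K.starProjection v) := by
  refine Submodule.eq_starProjection_of_mem_of_inner_eq_zero (h _ (K.starProjection_apply_mem v))
    fun w hw => ?_
  rw [← map_sub, inner_apply_left]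
  exact K.starProjection_inner_eq_zero v _ (h' w hw)

theorem exists_eq_star_mul_self [CompleteSpace H] {T : H →L[ℂ] H}
    (hT : ∀ v, ∃ r : ℝ, 0 ≤ r ∧ inner ℂ (T v) v = r) : ∃ R : H →L[ℂ] H, T = star R * R := by
  refine CStarAlgebra.nonneg_iff_eq_star_mul_self.1 ?_
  rw [ContinuousLinearMap.nonneg_iff_isPositive, ContinuousLinearMap.isPositive_iff_complex]
  intro v
  obtain ⟨r, hr, h⟩ := hT v
  rw [h]
  exact ⟨rfl, hr⟩

/-- The compression of an operator to a closed subspace. -/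
def compress (K : Submodule ℂ H) [K.HasOrthogonalProjection] : (H →L[ℂ] H) →ₗ[ℂ] (K →L[ℂ] K) where
  toFun T := K.orthogonalProjectionOnto.comp (T.comp K.subtypeL)
  map_add' S T := by ext; simp
  map_smul' c T := by ext; simp

variable (K : Submodule ℂ H) [K.HasOrthogonalProjection]

theorem coe_compress_apply (T : H →L[ℂ] H) (v : K) :
    (compress K T v : H) = K.starProjection (T v) := rfl

theorem compress_one : compress K 1 = 1 := by
  ext v
  rw [coe_compress_apply]
  simp

theorem compress_mul_left [CompleteSpace H] {S : H →L[ℂ] H}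
    (h : ∀ v ∈ K, S v ∈ K) (h' : ∀ v ∈ K, star S v ∈ K) (T : H →L[ℂ] H) :
    compress K (S * T) = compress K S * compress K T := by
  ext v
  rw [mul_apply_eq_comp, coe_compress_apply, coe_compress_apply, coe_compress_apply,
    mul_apply_eq_comp, K.starProjection_apply_comm h h',
    Submodule.starProjection_eq_self_iff.2 (h _ (K.starProjection_apply_mem _))]

theorem compress_mul_right {S : H →L[ℂ] H} (h : ∀ v ∈ K, S v ∈ K)
    (T : H →L[ℂ] H) : compress K (T * S) = compress K T * compress K S := by
  ext v
  rw [mul_apply_eq_comp, coe_compress_apply, coe_compress_apply, coe_compress_apply,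
    mul_apply_eq_comp, Submodule.starProjection_eq_self_iff.2 (h v v.2)]

/-- Compression is not multiplicative, but it preserves positivity. This makes a positive functional
on `B(K)` positive after composition with the compression. -/
theorem exists_compress_eq [CompleteSpace H] [CompleteSpace K] (T : H →L[ℂ] H) :
    ∃ R : K →L[ℂ] K, compress K (star T * T) = star R * R := by
  refine exists_eq_star_mul_self fun v => ⟨‖T v‖ ^ 2, by positivity, ?_⟩
  rw [Submodule.coe_inner, coe_compress_apply, Submodule.inner_starProjection_left_eq_right,
    Submodule.starProjection_eq_self_iff.2 v.2, mul_apply_eq_comp,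
    ← inner_apply_right, inner_self_eq_norm_sq_to_K]
  push_cast
  rfl

/-- The Cauchy-Schwarz inequality for positive functionals. -/
theorem norm_sq_le_of_positive {B : Type*} [Ring B] [StarRing B] [Algebra ℂ B] [StarModule ℂ B]
    (φ : B →ₗ[ℂ] ℂ) (hφ : ∀ T, 0 ≤ φ (star T * T)) (S T : B) :
    ‖φ (star S * T)‖ ^ 2 ≤ (φ (star S * S)).re * (φ (star T * T)).re := by
  -- Polarization: positivity at `S + T` and at `S + iT` makes the associated sesquilinear form
  -- hermitian.
  have hherm : ∀ S T, star (φ (star T * S)) = φ (star S * T) := fun S T => by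
    have him : ∀ T, (φ (star T * T)).im = 0 := fun T => ((Complex.le_def.1 (hφ T)).2).symm
    have h1 := him (S + T)
    have h2 := him (S + Complex.I • T)
    have e1 : star (S + T) * (S + T) = star S * S + star S * T + star T * S + star T * T := by
      rw [star_add]; noncomm_ring
    have e2 : star (S + Complex.I • T) * (S + Complex.I • T) =
        star S * S + Complex.I • (star S * T) - Complex.I • (star T * S) + star T * T := by
      rw [star_add, star_smul, Complex.star_def, Complex.conj_I]
      simp only [add_mul, mul_add, Algebra.smul_mul_assoc, Algebra.mul_smul_comm, neg_smul,
        neg_mul, smul_add, smul_neg, smul_smul, Complex.I_mul_I, one_smul]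
      abel
    rw [e1] at h1
    rw [e2] at h2
    simp only [map_add, map_sub, map_smul, Complex.add_im, Complex.sub_im, him, smul_eq_mul,
      Complex.mul_im, Complex.I_re, Complex.I_im] at h1 h2
    apply Complex.ext
    · change (φ (star T * S)).re = _
      linarith
    · change -(φ (star T * S)).im = _
      linarith
  let c : PreInnerProductSpace.Core ℂ B :=
    { inner := fun S T => φ (star S * T)
      conj_inner_symm := fun S T => hherm S T
      re_inner_nonneg := fun T => (Complex.le_def.1 (hφ T)).1
      add_left := fun x y z => by rw [star_add, add_mul, map_add]
      smul_left := fun x y r => by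
        rw [star_smul, smul_mul_assoc, map_smul]
        rfl }
  have := @InnerProductSpace.Core.inner_mul_inner_self_le ℂ B _ _ _ c S T
  have e : ‖φ (star T * S)‖ = ‖φ (star S * T)‖ := by rw [← hherm, norm_star]
  change ‖φ (star S * T)‖ * ‖φ (star T * S)‖ ≤ (φ (star S * S)).re * (φ (star T * T)).re at this
  rwa [e, ← sq] at this

theorem norm_le_of_positive {B : Type*} [Ring B] [StarRing B] [Algebra ℂ B] [StarModule ℂ B]
    (φ : B →ₗ[ℂ] ℂ) (hφ : ∀ T, 0 ≤ φ (star T * T)) (S T : B) :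
    ‖φ (star S * T)‖ ≤ √(φ (star S * S)).re * √(φ (star T * T)).re := by
  rw [← Real.sqrt_mul (Complex.le_def.1 (hφ S)).1]
  exact Real.le_sqrt_of_sq_le (norm_sq_le_of_positive φ hφ S T)

end Compression

namespace VonNeumannAlgebra

variable {H : Type*} [NormedAddCommGroup H] [InnerProductSpace ℂ H] [CompleteSpace H]

theorem apply_vector_mem_L2 (A : VonNeumannAlgebra H) (ξ : H) {a : H →L[ℂ] H} (ha : a ∈ A) :
    a ξ ∈ A.L2 ξ :=
  subset_closure ⟨a, ha, rfl⟩

theorem vector_mem_L2 (A : VonNeumannAlgebra H) (ξ : H) : ξ ∈ A.L2 ξ :=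
  A.apply_vector_mem_L2 ξ (one_mem A)

theorem L2_induction (A : VonNeumannAlgebra H) (ξ : H) {s : Set H} (hs : IsClosed s)
    (h : ∀ a ∈ A, a ξ ∈ s) {v : H} (hv : v ∈ A.L2 ξ) : v ∈ s := by
  refine closure_minimal ?_ hs hv
  rintro _ ⟨a, ha, rfl⟩
  exact h a ha

/-- A vector of `L²(A)` is determined by its inner products with the vectors `a ξ`. -/
theorem L2_ext (A : VonNeumannAlgebra H) (ξ : H) {v w : H} (hv : v ∈ A.L2 ξ) (hw : w ∈ A.L2 ξ)
    (h : ∀ a ∈ A, inner ℂ v (a ξ) = inner ℂ w (a ξ)) : v = w := by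
  have h0 : ∀ u ∈ A.L2 ξ, u ∈ {u | inner ℂ v u = inner ℂ w u} := fun u hu =>
    A.L2_induction ξ (isClosed_eq (by fun_prop) (by fun_prop)) h hu
  have h1 : inner ℂ v (v - w) = inner ℂ w (v - w) := h0 (v - w) (Submodule.sub_mem _ hv hw)
  rw [← sub_eq_zero, ← inner_sub_left] at h1
  exact sub_eq_zero.1 (inner_self_eq_zero.1 h1)

theorem starProjection_L2_apply_comm (A : VonNeumannAlgebra H) (ξ : H) {a : H →L[ℂ] H}
    (ha : a ∈ A) (v : H) : (A.L2 ξ).starProjection (a v) = a ((A.L2 ξ).starProjection v) :=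
  (A.L2 ξ).starProjection_apply_comm (fun _ hv => A.apply_mem_L2 ξ ha hv)
    (fun _ hv => A.apply_mem_L2 ξ (star_mem ha) hv) v

theorem starProjection_L2_mem_commutant (A : VonNeumannAlgebra H) (ξ : H) :
    (A.L2 ξ).starProjection ∈ A.commutant :=
  mem_commutant_iff.2 fun a ha => by
    ext v
    exact (A.starProjection_L2_apply_comm ξ ha v).symm

theorem leftMul_eq_compress (A : VonNeumannAlgebra H) (ξ : H) (a : A) :
    A.leftMul ξ a = compress (A.L2 ξ) (a : H →L[ℂ] H) := by
  ext v
  rw [coe_compress_apply, Submodule.starProjection_eq_self_iff.2 (A.apply_mem_L2 ξ a.2 v.2)]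
  rfl

/-- The square root commutes with everything that commutes with `T`, so the double commutant theorem
applies. -/
theorem sqrt_mem (A : VonNeumannAlgebra H) {T : H →L[ℂ] H} (hT : T ∈ A) : CFC.sqrt T ∈ A := by
  rw [← A.commutant_commutant, mem_commutant_iff] at hT ⊢
  intro g hg
  have h : Commute T g := (hT g hg).symm
  exact (h.cfcₙ_nnreal NNReal.sqrt).symm

/-- The modulus of `b`. -/
theorem exists_modulus (A : VonNeumannAlgebra H) {b : H →L[ℂ] H} (hb : b ∈ A) :
    ∃ R ∈ A, star R = R ∧ (∀ v, 0 ≤ (inner ℂ (R v) v).re) ∧ ∀ v, ‖R v‖ = ‖b v‖ := by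
  have hsa : star (CFC.sqrt (star b * b)) = CFC.sqrt (star b * b) :=
    (CFC.sqrt_nonneg _).isSelfAdjoint.star_eq
  have hRR : CFC.sqrt (star b * b) * CFC.sqrt (star b * b) = star b * b :=
    CFC.sqrt_mul_sqrt_self _ (star_mul_self_nonneg b)
  have hmem := A.sqrt_mem (mul_mem (star_mem hb) hb)
  have hpos := (ContinuousLinearMap.nonneg_iff_isPositive _).1 (CFC.sqrt_nonneg (star b * b))
  generalize CFC.sqrt (star b * b) = R at hsa hRR hmem hpos
  refine ⟨R, hmem, hsa, fun v => hpos.2 v, fun v => ?_⟩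
  have h1 : inner ℂ (R v) (R v) = inner ℂ (b v) (b v) := by
    have : R (R v) = star b (b v) := DFunLike.congr_fun hRR v
    rw [inner_apply_left, hsa, this, ← inner_apply_left]
  rw [inner_self_eq_norm_sq_to_K, inner_self_eq_norm_sq_to_K] at h1
  have h2 : ‖R v‖ ^ 2 = ‖b v‖ ^ 2 := by exact_mod_cast h1
  exact (pow_left_inj₀ (norm_nonneg _) (norm_nonneg _) two_ne_zero).1 h2

theorem commutant_le_commutant {A B : VonNeumannAlgebra H} (h : A ≤ B) :
    B.commutant ≤ A.commutant := fun _ hx =>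
  mem_commutant_iff.2 fun a ha => mem_commutant_iff.1 hx a (h ha)

/-- A bounded operator which is defined by its values on `A' ξ` and commutes with `A'`. -/
theorem exists_mem_apply_eq (A : VonNeumannAlgebra H) (ξ η : H) (C : ℝ)
    (hdense : Dense {v | ∃ b ∈ A.commutant, b ξ = v})
    (hbound : ∀ b ∈ A.commutant, ‖b η‖ ≤ C * ‖b ξ‖) :
    ∃ E ∈ A, ∀ b ∈ A.commutant, E (b ξ) = b η := by
  let M' : Submodule ℂ (H →L[ℂ] H) := A.commutant.toSubalgebra.toSubmodule
  let f : M' →ₗ[ℂ] H := (ContinuousLinearMap.apply ℂ H η).toLinearMap ∘ₗ M'.subtype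
  let e : M' →ₗ[ℂ] H := (ContinuousLinearMap.apply ℂ H ξ).toLinearMap ∘ₗ M'.subtype
  have hd : DenseRange e := by
    refine hdense.mono ?_
    rintro _ ⟨b, hb, rfl⟩
    exact ⟨⟨b, hb⟩, rfl⟩
  have hE : ∀ b ∈ A.commutant, f.extendOfNorm e (b ξ) = b η := fun b hb =>
    f.extendOfNorm_eq hd ⟨C, fun x => hbound x x.2⟩ ⟨b, hb⟩
  refine ⟨f.extendOfNorm e, ?_, hE⟩
  rw [← A.commutant_commutant, mem_commutant_iff]
  intro b hb
  have : (fun v => (b * f.extendOfNorm e) v) = fun v => (f.extendOfNorm e * b) v := by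
    refine Continuous.ext_on hdense (by fun_prop) (by fun_prop) ?_
    rintro _ ⟨c, hc, rfl⟩
    change b (f.extendOfNorm e (c ξ)) = f.extendOfNorm e (b (c ξ))
    rw [hE c hc]
    exact (hE (b * c) (mul_mem hb hc)).symm
  ext v
  exact congrFun this v

end VonNeumannAlgebra

/-! ## The regular representations and the conjugation on `ℓ²(Γ)` -/

section Dirac

variable {Γ : Type*}

open Classical in
/-- The Dirac function at `g`. -/
def dirac (g : Γ) : ℓ²(Γ, ℂ) := lp.single 2 g (1 : ℂ)

theorem inner_dirac_left (g : Γ) (f : ℓ²(Γ, ℂ)) : inner ℂ (dirac g) f = f g := by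
  classical
  rw [dirac, lp.inner_single_left]
  simp

theorem inner_dirac_right (g : Γ) (f : ℓ²(Γ, ℂ)) : inner ℂ f (dirac g) = star (f g) := by
  rw [← inner_conj_symm, inner_dirac_left]
  rfl

theorem dirac_apply_self (g : Γ) : (dirac g : Γ → ℂ) g = 1 := by
  classical
  rw [dirac, lp.single_apply_self]

theorem dirac_apply_ne {g h : Γ} (hgh : h ≠ g) : (dirac g : Γ → ℂ) h = 0 := by
  classical
  rw [dirac, lp.single_apply_ne _ _ _ hgh]

theorem norm_dirac (g : Γ) : ‖dirac g‖ = 1 := by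
  classical
  rw [dirac, lp.norm_single (by norm_num)]
  simp

theorem hasSum_dirac (f : ℓ²(Γ, ℂ)) : HasSum (fun g => f g • dirac g) f := by
  classical
  have := lp.hasSum_single (p := 2) (by norm_num) f
  convert this using 2 with g
  rw [dirac, ← lp.single_smul]
  simp

theorem hasSum_apply_dirac (S : ℓ²(Γ, ℂ) →L[ℂ] ℓ²(Γ, ℂ)) (f : ℓ²(Γ, ℂ)) (k : Γ) :
    HasSum (fun g => f g * S (dirac g) k) (S f k) := by
  have h := (innerSL ℂ (dirac k)).hasSum (S.hasSum (hasSum_dirac f))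
  simp only [map_smul, innerSL_apply_apply, inner_dirac_left, smul_eq_mul] at h
  exact h

theorem dense_span_dirac : Dense (Submodule.span ℂ (Set.range (dirac (Γ := Γ))) : Set ℓ²(Γ, ℂ)) :=
  fun f => mem_closure_of_tendsto (hasSum_dirac f) <| Eventually.of_forall fun _ =>
    Submodule.sum_mem _ fun g _ => Submodule.smul_mem _ _ (Submodule.subset_span ⟨g, rfl⟩)

theorem ext_dirac {S T : ℓ²(Γ, ℂ) →L[ℂ] ℓ²(Γ, ℂ)} (h : ∀ g, S (dirac g) = T (dirac g)) : S = T := by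
  refine ContinuousLinearMap.ext_on dense_span_dirac ?_
  rintro _ ⟨g, rfl⟩
  exact h g

end Dirac

section Regular

variable {Γ : Type*} [Group Γ]

theorem leftRegular_dirac (g h : Γ) : leftRegular g (dirac h) = dirac (g * h) := by
  ext x
  rw [leftRegular_apply]
  by_cases hx : x = g * h
  · subst hx
    rw [inv_mul_cancel_left, dirac_apply_self, dirac_apply_self]
  · rw [dirac_apply_ne hx, dirac_apply_ne]
    rintro rfl
    simp at hx

theorem leftRegular_one : leftRegular (1 : Γ) = 1 := by
  ext f x
  rw [leftRegular_apply, inv_one, one_mul]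
  rfl

theorem leftRegular_mul (g h : Γ) : leftRegular (g * h) = leftRegular g * leftRegular h := by
  ext f x
  rw [leftRegular_apply, mul_apply_eq_comp, leftRegular_apply, leftRegular_apply,
    mul_inv_rev, mul_assoc]

theorem star_leftRegular (g : Γ) : star (leftRegular g) = leftRegular g⁻¹ := by
  refine ContinuousLinearMap.ext fun f => ?_
  ext x
  rw [← inner_dirac_left, ← inner_apply_left, leftRegular_dirac, leftRegular_apply, inv_inv,
    inner_dirac_left]

/-- The canonical conjugation `(J f)(x) = conj (f x⁻¹)` on `ℓ²(Γ)`. -/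
def conjugation (Γ : Type*) [Group Γ] : ℓ²(Γ, ℂ) →ₗᵢ⋆[ℂ] ℓ²(Γ, ℂ) where
  toFun f := ⟨fun x => star (f x⁻¹), by
    have hp : 0 < (2 : ENNReal).toReal := by norm_num
    have h := (memℓp_gen_iff hp).1 (lp.memℓp f)
    refine (memℓp_gen_iff hp).2 ?_
    simp only [norm_star]
    exact (Equiv.inv Γ).summable_iff.2 h⟩
  map_add' f f' := by ext x; exact star_add _ _
  map_smul' c f := by ext x; exact star_mul' _ _
  norm_map' f := by
    have hp : 0 < (2 : ENNReal).toReal := by norm_num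
    rw [lp.norm_eq_tsum_rpow hp, lp.norm_eq_tsum_rpow hp]
    congr 1
    change ∑' x, ‖star (f x⁻¹)‖ ^ _ = _
    simp only [norm_star]
    exact (Equiv.inv Γ).tsum_eq fun x => ‖f x‖ ^ (2 : ENNReal).toReal

theorem conjugation_apply (f : ℓ²(Γ, ℂ)) (x : Γ) : conjugation Γ f x = star (f x⁻¹) := rfl

@[simp]
theorem conjugation_conjugation (f : ℓ²(Γ, ℂ)) : conjugation Γ (conjugation Γ f) = f := by
  ext x
  rw [conjugation_apply, conjugation_apply, inv_inv, star_star]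

theorem conjugation_dirac (g : Γ) : conjugation Γ (dirac g) = dirac g⁻¹ := by
  ext x
  rw [conjugation_apply]
  by_cases hx : x = g⁻¹
  · subst hx; rw [inv_inv, dirac_apply_self, dirac_apply_self, star_one]
  · rw [dirac_apply_ne hx, dirac_apply_ne (fun h => hx (inv_eq_iff_eq_inv.1 h)), star_zero]

theorem inner_conjugation_conjugation (f f' : ℓ²(Γ, ℂ)) :
    inner ℂ (conjugation Γ f) (conjugation Γ f') = inner ℂ f' f := by
  rw [lp.inner_eq_tsum, lp.inner_eq_tsum, ← (Equiv.inv Γ).tsum_eq fun i => inner ℂ (f' i) (f i)]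
  refine tsum_congr fun x => ?_
  simp [conjugation_apply, mul_comm]

theorem inner_conjugation_left (f f' : ℓ²(Γ, ℂ)) :
    inner ℂ (conjugation Γ f) f' = inner ℂ (conjugation Γ f') f := by
  rw [← inner_conjugation_conjugation, conjugation_conjugation]

/-- The operator `J T J`. -/
def conjOp (T : ℓ²(Γ, ℂ) →L[ℂ] ℓ²(Γ, ℂ)) : ℓ²(Γ, ℂ) →L[ℂ] ℓ²(Γ, ℂ) :=
  (conjugation Γ).toContinuousLinearMap.comp (T.comp (conjugation Γ).toContinuousLinearMap)

theorem conjOp_apply (T : ℓ²(Γ, ℂ) →L[ℂ] ℓ²(Γ, ℂ)) (f : ℓ²(Γ, ℂ)) :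
    conjOp T f = conjugation Γ (T (conjugation Γ f)) := rfl

theorem star_conjOp (T : ℓ²(Γ, ℂ) →L[ℂ] ℓ²(Γ, ℂ)) : star (conjOp T) = conjOp (star T) := by
  refine ContinuousLinearMap.ext fun f => ext_inner_left ℂ fun f' => ?_
  rw [← inner_apply_left, conjOp_apply, conjOp_apply, inner_conjugation_left, inner_apply_right,
    ← inner_conjugation_conjugation, conjugation_conjugation]

theorem conjOp_leftRegular_apply (g : Γ) (f : ℓ²(Γ, ℂ)) (x : Γ) :
    conjOp (leftRegular g) f x = f (x * g) := by
  rw [conjOp_apply, conjugation_apply, leftRegular_apply, conjugation_apply]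
  simp

theorem conjOp_leftRegular_comm (g h : Γ) :
    leftRegular h * conjOp (leftRegular g) = conjOp (leftRegular g) * leftRegular h := by
  ext f x
  simp only [mul_apply_eq_comp, leftRegular_apply, conjOp_leftRegular_apply, mul_assoc]

theorem conjOp_leftRegular_dirac (g h : Γ) :
    conjOp (leftRegular g) (dirac h) = dirac (h * g⁻¹) := by
  rw [conjOp_apply, conjugation_dirac, leftRegular_dirac, conjugation_dirac]
  simp

end Regular

/-! ## Group von Neumann algebras and their subalgebras -/

section GroupVN

variable {Γ : Type*} [Group Γ]

open VonNeumannAlgebra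

theorem mem_groupVN_iff {Λ : Subgroup Γ} {x : ℓ²(Γ, ℂ) →L[ℂ] ℓ²(Γ, ℂ)} :
    x ∈ groupVN Λ ↔ ∀ T : ℓ²(Γ, ℂ) →L[ℂ] ℓ²(Γ, ℂ),
      (∀ g ∈ Λ, leftRegular g * T = T * leftRegular g) → T * x = x * T := by
  rw [groupVN, generatedBy, mem_commutant_iff]
  refine forall_congr' fun T => imp_congr_left ?_
  rw [mem_commutantOf]
  constructor
  · exact fun h g hg => (h _ ⟨g, hg, rfl⟩).1
  · rintro h _ ⟨g, hg, rfl⟩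
    rw [star_leftRegular]
    exact ⟨h g hg, h g⁻¹ (Λ.inv_mem hg)⟩

theorem groupVN_mono {Λ Λ' : Subgroup Γ} (h : Λ ≤ Λ') : groupVN Λ ≤ groupVN Λ' := fun _ hx =>
  mem_groupVN_iff.2 fun T hT => mem_groupVN_iff.1 hx T fun g hg => hT g (h hg)

theorem leftRegular_mem {Λ : Subgroup Γ} {g : Γ} (hg : g ∈ Λ) : leftRegular g ∈ groupVN Λ :=
  mem_groupVN_iff.2 fun _ hT => (hT g hg).symm

/-- The operators `J λ_g J` are the right translations, which commute with the left ones. -/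
theorem conjOp_leftRegular_mem_commutant (Λ : Subgroup Γ) (g : Γ) :
    conjOp (leftRegular g) ∈ (groupVN Λ).commutant :=
  mem_commutant_iff.2 fun _ hx =>
    (mem_groupVN_iff.1 hx _ fun h _ => conjOp_leftRegular_comm g h).symm

theorem mul_conjOp_leftRegular {Λ : Subgroup Γ} {x : ℓ²(Γ, ℂ) →L[ℂ] ℓ²(Γ, ℂ)}
    (hx : x ∈ groupVN Λ) (g : Γ) (f : ℓ²(Γ, ℂ)) :
    x (conjOp (leftRegular g) f) = conjOp (leftRegular g) (x f) :=
  DFunLike.congr_fun (mem_commutant_iff.1 (conjOp_leftRegular_mem_commutant Λ g) x hx) f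

/-- The matrix coefficients of an element of the group von Neumann algebra. -/
theorem groupVN_dirac_apply {Λ : Subgroup Γ} {x : ℓ²(Γ, ℂ) →L[ℂ] ℓ²(Γ, ℂ)}
    (hx : x ∈ groupVN Λ) (g h : Γ) : x (dirac g) h = x (dirac 1) (h * g⁻¹) := by
  have := mul_conjOp_leftRegular hx g⁻¹ (dirac 1)
  rw [conjOp_leftRegular_dirac, one_mul, inv_inv] at this
  rw [this, conjOp_leftRegular_apply]

/-- On `LΓ δ₁`, the conjugation `J` is the map `x δ₁ ↦ x* δ₁`; this is where traciality enters. -/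
theorem conjugation_apply_dirac_one {Λ : Subgroup Γ} {x : ℓ²(Γ, ℂ) →L[ℂ] ℓ²(Γ, ℂ)}
    (hx : x ∈ groupVN Λ) : conjugation Γ (x (dirac 1)) = star x (dirac 1) := by
  ext g
  rw [conjugation_apply, ← inner_dirac_left g, ← inner_apply_left, inner_dirac_right,
    groupVN_dirac_apply hx g, one_mul]

/-- Since `x` commutes with right translations, `J x J` commutes with left ones. -/
theorem conjOp_mem_commutant {Λ : Subgroup Γ} {x : ℓ²(Γ, ℂ) →L[ℂ] ℓ²(Γ, ℂ)}
    (hx : x ∈ groupVN Λ) : conjOp x ∈ (groupVN Λ).commutant := by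
  refine mem_commutant_iff.2 fun y hy => (mem_groupVN_iff.1 hy _ fun g _ => ?_).symm
  ext1 f
  have h := mul_conjOp_leftRegular hx g (conjugation Γ f)
  rw [conjOp_apply, conjugation_conjugation] at h
  have h' := congrArg (conjugation Γ) h
  rw [conjOp_apply (leftRegular g), conjugation_conjugation] at h'
  exact h'.symm

variable {A : VonNeumannAlgebra ℓ²(Γ, ℂ)}

theorem conjugation_mem_L2 (hA : A ≤ groupVN ⊤) {v : ℓ²(Γ, ℂ)} (hv : v ∈ A.L2 (dirac 1)) :
    conjugation Γ v ∈ A.L2 (dirac 1) := by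
  refine A.L2_induction (dirac 1)
    (s := (conjugation Γ) ⁻¹' (A.L2 (dirac 1) : Set ℓ²(Γ, ℂ))) ?_ (fun a ha => ?_) hv
  · exact (Submodule.isClosed_topologicalClosure _).preimage (conjugation Γ).continuous
  · rw [Set.mem_preimage, conjugation_apply_dirac_one (hA ha)]
    exact A.apply_vector_mem_L2 _ (star_mem ha)

theorem starProjection_conjOp (hA : A ≤ groupVN ⊤) {a : ℓ²(Γ, ℂ) →L[ℂ] ℓ²(Γ, ℂ)} (ha : a ∈ A)
    (v : ℓ²(Γ, ℂ)) : (A.L2 (dirac 1)).starProjection (conjOp a v) =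
      conjOp a ((A.L2 (dirac 1)).starProjection v) := by
  have h : ∀ a ∈ A, ∀ v ∈ A.L2 (dirac 1), conjOp a v ∈ A.L2 (dirac 1) := fun a ha v hv =>
    conjugation_mem_L2 hA (A.apply_mem_L2 _ ha (conjugation_mem_L2 hA hv))
  refine Submodule.starProjection_apply_comm _ (h a ha) ?_ v
  rw [star_conjOp]
  exact h _ (star_mem ha)

/-- The vector `T δ₁` is fixed by the conjugation if `T = T*` lies in the commutant of `A` and maps
into `L²(A)`. -/
theorem conjugation_eq_of_mem_commutant (hA : A ≤ groupVN ⊤) {T : ℓ²(Γ, ℂ) →L[ℂ] ℓ²(Γ, ℂ)}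
    (hT : T ∈ A.commutant) (hsa : star T = T) (hK : T (dirac 1) ∈ A.L2 (dirac 1)) :
    conjugation Γ (T (dirac 1)) = T (dirac 1) := by
  refine A.L2_ext (dirac 1) (conjugation_mem_L2 hA hK) hK fun a ha => ?_
  have hc : T (a (dirac 1)) = a (T (dirac 1)) :=
    (DFunLike.congr_fun (mem_commutant_iff.1 hT a ha) (dirac 1)).symm
  rw [inner_conjugation_left, conjugation_apply_dirac_one (hA ha), ← inner_apply_right,
    inner_apply_left T, hsa, hc]

/-- The commutation theorem on `L²(A)` for elements of the ambient group von Neumann algebra. -/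
theorem apply_starProjection_comm (hA : A ≤ groupVN ⊤) {R x : ℓ²(Γ, ℂ) →L[ℂ] ℓ²(Γ, ℂ)}
    (hR : R ∈ A.commutant) (hsa : star R = R) (hK : ∀ v, R v ∈ A.L2 (dirac 1))
    (hx : x ∈ groupVN (⊤ : Subgroup Γ)) :
    R ((A.L2 (dirac 1)).starProjection (x (dirac 1))) =
      (A.L2 (dirac 1)).starProjection (x (R (dirac 1))) := by
  refine A.L2_ext (dirac 1) (hK _) ((A.L2 (dirac 1)).starProjection_apply_mem _) fun b hb => ?_
  have hc : R (b (dirac 1)) = b (R (dirac 1)) :=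
    (DFunLike.congr_fun (mem_commutant_iff.1 hR b hb) (dirac 1)).symm
  have hbx : star b * x ∈ groupVN (⊤ : Subgroup Γ) := mul_mem (star_mem (hA hb)) hx
  rw [inner_apply_left, hsa, Submodule.inner_starProjection_left_eq_right,
    Submodule.starProjection_eq_self_iff.2 (hK _), hc,
    Submodule.inner_starProjection_left_eq_right,
    Submodule.starProjection_eq_self_iff.2 (A.apply_vector_mem_L2 _ hb),
    inner_apply_left x (R (dirac 1))]
  -- Both `x* b δ₁` and `R δ₁` are now written through `J`, which reverses the inner product and
  -- brings `x` back to the other side.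
  have h : star x (b (dirac 1)) = conjugation Γ ((star b * x) (dirac 1)) := by
    rw [conjugation_apply_dirac_one hbx, star_mul, star_star]
    rfl
  rw [h, ← conjugation_eq_of_mem_commutant hA hR hsa (hK _), inner_conjugation_conjugation,
    conjugation_eq_of_mem_commutant hA hR hsa (hK _), mul_apply_eq_comp, inner_apply_left (star b),
    star_star]

/-- The bound that makes `b δ₁ ↦ b e(x δ₁)` a bounded operator, where `e` is the projection onto
`L²(A)`. Replacing `b` by the modulus `R` of `b e` leaves the norms unchanged and makes the
commutation `R e x δ₁ = e x R δ₁` available. -/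
theorem norm_commutant_apply_le (hA : A ≤ groupVN ⊤) {b x : ℓ²(Γ, ℂ) →L[ℂ] ℓ²(Γ, ℂ)}
    (hb : b ∈ A.commutant) (hx : x ∈ groupVN (⊤ : Subgroup Γ)) :
    ‖b ((A.L2 (dirac 1)).starProjection (x (dirac 1)))‖ ≤ ‖x‖ * ‖b (dirac 1)‖ := by
  set e := (A.L2 (dirac 1)).starProjection with he
  have heA : e ∈ A.commutant := A.starProjection_L2_mem_commutant _
  have hee : ∀ v, e (e v) = e v := fun v =>
    Submodule.starProjection_eq_self_iff.2 (Submodule.starProjection_apply_mem _ v)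
  obtain ⟨R, hRA, hRsa, -, hnorm⟩ := A.commutant.exists_modulus (mul_mem hb heA)
  change ∀ v, ‖R v‖ = ‖b (e v)‖ at hnorm
  have hRe : ∀ v, R (e v) = R v := fun v => by
    rw [← sub_eq_zero, ← map_sub, ← norm_eq_zero, hnorm, map_sub e, hee, sub_self, map_zero,
      norm_zero]
  -- Taking adjoints in `R e = R` shows that `R` maps into `L²(A)`.
  have heR : ∀ v, e (R v) = R v := fun v => by
    refine ext_inner_left ℂ fun w => ?_
    rw [he, ← Submodule.inner_starProjection_left_eq_right, ← he, inner_apply_right,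
      inner_apply_right, hRsa, hRe]
  have hK : ∀ v, R v ∈ A.L2 (dirac 1) := fun v =>
    Submodule.starProjection_eq_self_iff.1 (heR v)
  have he1 : e (dirac 1) = dirac 1 := Submodule.starProjection_eq_self_iff.2 (A.vector_mem_L2 _)
  calc ‖b (e (x (dirac 1)))‖ = ‖R (e (x (dirac 1)))‖ := by rw [hnorm, hee]
    _ = ‖e (x (R (dirac 1)))‖ := by rw [apply_starProjection_comm hA hRA hRsa hK hx]
    _ ≤ ‖x (R (dirac 1))‖ := Submodule.norm_starProjection_apply_le _ _
    _ ≤ ‖x‖ * ‖R (dirac 1)‖ := x.le_opNorm _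
    _ = ‖x‖ * ‖b (dirac 1)‖ := by rw [hnorm, he1]

/-- The trace-preserving conditional expectation onto `A`: the compression of an element of the
ambient group von Neumann algebra to `L²(A)` is an element of `A`. -/
theorem exists_leftMul_eq_compress (hA : A ≤ groupVN ⊤) {x : ℓ²(Γ, ℂ) →L[ℂ] ℓ²(Γ, ℂ)}
    (hx : x ∈ groupVN (⊤ : Subgroup Γ)) :
    ∃ E : A, A.leftMul (dirac 1) E = compress (A.L2 (dirac 1)) x := by
  have hcomm := commutant_le_commutant hA
  obtain ⟨E, hE, hval⟩ := A.exists_mem_apply_eq (dirac 1)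
    ((A.L2 (dirac 1)).starProjection (x (dirac 1))) ‖x‖ (by
      refine (dense_span_dirac (Γ := Γ)).mono ?_
      let D : Submodule ℂ ℓ²(Γ, ℂ) := A.commutant.toSubalgebra.toSubmodule.map
        (ContinuousLinearMap.apply ℂ ℓ²(Γ, ℂ) (dirac 1)).toLinearMap
      -- The vectors `b δ₁` with `b ∈ A'` are dense, since right translations move `δ₁` to every
      -- Dirac function.
      have : Submodule.span ℂ (Set.range dirac) ≤ D := by
        rw [Submodule.span_le]
        rintro _ ⟨g, rfl⟩
        refine ⟨conjOp (leftRegular g⁻¹), hcomm (conjOp_leftRegular_mem_commutant ⊤ _), ?_⟩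
        change conjOp (leftRegular g⁻¹) (dirac 1) = _
        rw [conjOp_leftRegular_dirac, one_mul, inv_inv]
      exact this) fun b hb => norm_commutant_apply_le hA hb hx
  refine ⟨⟨E, hE⟩, ?_⟩
  ext1 v
  refine Subtype.ext ?_
  rw [coe_compress_apply]
  change E v = _
  have hv : (v : ℓ²(Γ, ℂ)) ∈ {v | E v = (A.L2 (dirac 1)).starProjection (x v)} := by
    refine A.L2_induction (dirac 1) (isClosed_eq (by fun_prop) (by fun_prop)) (fun a ha => ?_) v.2
    -- Writing `a δ₁ = J a* J δ₁` replaces `a` by an element of the commutant, on which `E` is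
    -- known.
    have h1 : a (dirac 1) = conjOp (star a) (dirac 1) := by
      rw [conjOp_apply, conjugation_dirac, inv_one,
        conjugation_apply_dirac_one (star_mem (hA ha)), star_star]
    have hJ := conjOp_mem_commutant (star_mem (hA ha))
    rw [Set.mem_ofPred_eq, h1, hval _ (hcomm hJ), ← starProjection_conjOp hA (star_mem ha)]
    congr 1
    exact (DFunLike.congr_fun (mem_commutant_iff.1 hJ x hx) (dirac 1)).symm
  exact hv

/-- A hypertrace of an amenable subalgebra `A` of `LΓ` extends to an `A`-central state on
`B(ℓ²(Γ))` whose restriction to `LΓ` is the trace. -/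
theorem exists_central_state (hA : A ≤ groupVN ⊤) (hamen : A.IsAmenable (dirac 1)) :
    ∃ φ : (ℓ²(Γ, ℂ) →L[ℂ] ℓ²(Γ, ℂ)) →ₗ[ℂ] ℂ, (∀ T, 0 ≤ φ (star T * T)) ∧
      (∀ a ∈ A, ∀ T, φ (a * T) = φ (T * a)) ∧
      ∀ x ∈ groupVN (⊤ : Subgroup Γ), φ x = x (dirac 1) 1 := by
  obtain ⟨φ, -, hpos, hcent, htr⟩ := hamen
  refine ⟨φ ∘ₗ compress (A.L2 (dirac 1)), fun T => ?_, fun a ha T => ?_, fun x hx => ?_⟩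
  · obtain ⟨R, hR⟩ := exists_compress_eq (A.L2 (dirac 1)) T
    rw [LinearMap.comp_apply, hR]
    exact hpos R
  · have h1 : ∀ v ∈ A.L2 (dirac 1), a v ∈ A.L2 (dirac 1) := fun v hv => A.apply_mem_L2 _ ha hv
    have h2 : ∀ v ∈ A.L2 (dirac 1), star a v ∈ A.L2 (dirac 1) := fun v hv =>
      A.apply_mem_L2 _ (star_mem ha) hv
    have := hcent ⟨a, ha⟩ (compress _ T)
    rw [leftMul_eq_compress] at this
    rw [LinearMap.comp_apply, LinearMap.comp_apply, compress_mul_left _ h1 h2,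
      compress_mul_right _ h1]
    exact this
  · obtain ⟨E, hE⟩ := exists_leftMul_eq_compress hA hx
    -- The expectation preserves the trace because `δ₁` lies in `L²(A)`.
    have h1 : (E : ℓ²(Γ, ℂ) →L[ℂ] ℓ²(Γ, ℂ)) (dirac 1) =
        (A.L2 (dirac 1)).starProjection (x (dirac 1)) :=
      congrArg Subtype.val
        (DFunLike.congr_fun hE (⟨dirac 1, A.vector_mem_L2 _⟩ : A.L2 (dirac 1)))
    rw [LinearMap.comp_apply, ← hE, htr, h1, ← Submodule.inner_starProjection_left_eq_right,
      Submodule.starProjection_eq_self_iff.2 (A.vector_mem_L2 _), inner_dirac_left]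

/-- An element of `LΓ` whose Fourier coefficients are supported on `Λ` lies in `LΛ`. -/
theorem mem_groupVN_of_support {Λ : Subgroup Γ} {x : ℓ²(Γ, ℂ) →L[ℂ] ℓ²(Γ, ℂ)}
    (hx : x ∈ groupVN (⊤ : Subgroup Γ)) (hsupp : ∀ g, g ∉ Λ → x (dirac 1) g = 0) :
    x ∈ groupVN Λ := by
  refine mem_groupVN_iff.2 fun T hT => ?_
  refine ext_dirac fun h => ?_
  ext k
  have hTl : ∀ s ∈ Λ, ∀ u v, T (dirac u) (s⁻¹ * v) = T (dirac (s * u)) v := fun s hs u v => by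
    have := DFunLike.congr_fun (hT s hs) (dirac u)
    rw [mul_apply_eq_comp, mul_apply_eq_comp, leftRegular_dirac] at this
    rw [← this, leftRegular_apply]
  -- The matrix coefficients of `T x` and `x T` are expanded over the Fourier coefficients of `x`.
  -- Terms with `s ∈ Λ` agree since `T` commutes with `λ_s`; the others vanish. Only scalar series
  -- occur, so the Fourier series of `x` itself need not converge.
  have h1 : HasSum (fun s => x (dirac 1) s * T (dirac (s * h)) k) ((T * x) (dirac h) k) := by
    have hs := hasSum_apply_dirac T (x (dirac h)) k
    rw [← (Equiv.mulRight h).hasSum_iff] at hs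
    refine hs.congr_fun fun s => ?_
    change _ = x (dirac h) (s * h) * T (dirac (s * h)) k
    rw [groupVN_dirac_apply hx h, mul_inv_cancel_right]
  have h2 : HasSum (fun s => x (dirac 1) s * T (dirac h) (s⁻¹ * k)) ((x * T) (dirac h) k) := by
    have hs := hasSum_apply_dirac x (T (dirac h)) k
    rw [← ((Equiv.inv Γ).trans (Equiv.mulRight k)).hasSum_iff] at hs
    refine hs.congr_fun fun s => ?_
    change _ = T (dirac h) (s⁻¹ * k) * x (dirac (s⁻¹ * k)) k
    rw [groupVN_dirac_apply hx (s⁻¹ * k), mul_inv_rev, inv_inv, mul_inv_cancel_left, mul_comm]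
  refine h1.unique ?_
  convert h2 using 1
  ext s
  by_cases hs : s ∈ Λ
  · rw [hTl s hs]
  · rw [hsupp s hs, zero_mul, zero_mul]

end GroupVN

/-! ### Bounded functions as multiplication operators -/

section Multiplication

variable {Γ : Type*}

/-- Multiplication by a bounded real function on `ℓ²(Γ)`. -/
def mulOp : lp (fun _ : Γ => ℝ) ⊤ →ₗ[ℝ] (ℓ²(Γ, ℂ) →L[ℂ] ℓ²(Γ, ℂ)) where
  toFun f := LinearMap.mkContinuous
    { toFun := fun v => ⟨fun g => (f g : ℂ) * v g, by
        refine ((lp.memℓp v).norm.const_mul ‖f‖).mono fun g => ?_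
        rw [norm_mul, Complex.norm_real]
        exact mul_le_mul_of_nonneg_right (lp.norm_apply_le_norm ENNReal.top_ne_zero f g)
          (norm_nonneg _)⟩
      map_add' := fun v w => by ext g; exact mul_add _ _ _
      map_smul' := fun c v => by ext g; exact mul_left_comm _ _ _ } ‖f‖ fun v => by
    have h : ‖(‖f‖ : ℂ) • v‖ = ‖f‖ * ‖v‖ := by rw [norm_smul]; simp
    rw [← h]
    refine lp.norm_mono two_ne_zero fun g => ?_
    change ‖(f g : ℂ) * v g‖ ≤ ‖(‖f‖ : ℂ) * v g‖
    rw [norm_mul, norm_mul, Complex.norm_real, Complex.norm_real, norm_norm]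
    exact mul_le_mul_of_nonneg_right (lp.norm_apply_le_norm ENNReal.top_ne_zero f g)
      (norm_nonneg _)
  map_add' f f' := by
    ext v g
    change ((f g + f' g : ℝ) : ℂ) * v g = f g * v g + f' g * v g
    push_cast
    ring
  map_smul' c f := by
    ext v g
    change ((c * f g : ℝ) : ℂ) * v g = c • ((f g : ℂ) * v g)
    rw [Complex.real_smul]
    push_cast
    ring

theorem mulOp_apply (f : lp (fun _ : Γ => ℝ) ⊤) (v : ℓ²(Γ, ℂ)) (g : Γ) :
    mulOp f v g = f g * v g := rfl

theorem star_mulOp (f : lp (fun _ : Γ => ℝ) ⊤) : star (mulOp f) = mulOp f := by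
  refine ContinuousLinearMap.ext fun v => ext_inner_left ℂ fun w => ?_
  rw [← inner_apply_left, lp.inner_eq_tsum, lp.inner_eq_tsum]
  refine tsum_congr fun g => ?_
  simp only [mulOp_apply]
  simp [mul_left_comm, mul_assoc]

theorem mulOp_mul (f f' : lp (fun _ : Γ => ℝ) ⊤) : mulOp (f * f') = mulOp f * mulOp f' := by
  ext v g
  change ((f g * f' g : ℝ) : ℂ) * v g = f g * (f' g * v g)
  push_cast
  ring

theorem mulOp_one : mulOp (1 : lp (fun _ : Γ => ℝ) ⊤) = 1 := by
  ext v g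
  change ((1 : ℝ) : ℂ) * v g = v g
  simp

theorem mulOp_mul_leftRegular [Group Γ] (f : lp (fun _ : Γ => ℝ) ⊤) (g : Γ) :
    mulOp f * leftRegular g = leftRegular g * mulOp (lpTranslate g⁻¹ f) := by
  ext v x
  change (f x : ℂ) * v (g⁻¹ * x) = (f (g⁻¹⁻¹ * (g⁻¹ * x)) : ℂ) * v (g⁻¹ * x)
  rw [inv_inv, mul_inv_cancel_left]

end Multiplication

/-! ### Amenable algebras between `LΛ` and `LΓ` -/

section MaximalAmenable

open MeasureTheory VonNeumannAlgebra

variable {Γ X : Type*} [Group Γ] [TopologicalSpace X] [CompactSpace X] [MulAction Γ X]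

/-- The restriction of a continuous function on `X` to the orbit of a point. -/
def orbitFun (Γ : Type*) [Group Γ] [MulAction Γ X] (x : X) :
    C(X, ℝ) →ₗ[ℝ] lp (fun _ : Γ => ℝ) ⊤ where
  toFun f := ⟨fun g => f (g • x), memℓp_infty ⟨‖f‖, by
    rintro _ ⟨g, rfl⟩
    exact f.norm_coe_le_norm _⟩⟩
  map_add' _ _ := rfl
  map_smul' _ _ := rfl

theorem orbitFun_apply (x : X) (f : C(X, ℝ)) (g : Γ) : orbitFun Γ x f g = f (g • x) := rfl

variable [T2Space X] [MeasurableSpace X] [BorelSpace X]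

/-- An `LΛ`-central state on `B(ℓ²(Γ))` restricts to evaluation at `x` on `C(X)`, if every
`Λ`-invariant measure is concentrated at `x`. -/
theorem state_orbitFun_eq {Λ : Subgroup Γ} {x : X}
    (hcont : ∀ g : Γ, Continuous fun y : X => g • y)
    (hinv : ∀ μ : Measure X, IsFiniteMeasure μ → (∀ h ∈ Λ, μ.map (fun y => h • y) = μ) →
      ∀ᵐ y ∂μ, y = x)
    (φ : (ℓ²(Γ, ℂ) →L[ℂ] ℓ²(Γ, ℂ)) →ₗ[ℂ] ℂ) (hone : φ 1 = 1) (hpos : ∀ T, 0 ≤ φ (star T * T))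
    (hcent : ∀ g ∈ Λ, ∀ T, φ (leftRegular g * T) = φ (T * leftRegular g)) (f : C(X, ℝ)) :
    (φ (mulOp (orbitFun Γ x f))).re = f x := by
  let ψ : C(X, ℝ) →ₗ[ℝ] ℝ :=
    Complex.reLm ∘ₗ φ.restrictScalars ℝ ∘ₗ mulOp ∘ₗ orbitFun Γ x
  have hψ : ∀ f, ψ f = (φ (mulOp (orbitFun Γ x f))).re := fun f => rfl
  have hψpos : ∀ f, 0 ≤ f → 0 ≤ ψ f := fun f hf => by
    -- A nonnegative function is the square of a real function, so its multiplication operator has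
    -- the form `S* S`.
    let s : C(X, ℝ) := ⟨fun y => √(f y), by fun_prop⟩
    have hs : orbitFun Γ x f = orbitFun Γ x s * orbitFun Γ x s := by
      ext g
      exact (Real.mul_self_sqrt (hf (g • x))).symm
    rw [hψ, hs, mulOp_mul]
    nth_rewrite 1 [← star_mulOp]
    exact (Complex.le_def.1 (hpos _)).1
  have hψinv : ∀ h ∈ Λ, ∀ f f' : C(X, ℝ), (∀ y, f' y = f (h • y)) → ψ f' = ψ f :=
    fun h hh f f' hf => by
      have h1 := mulOp_mul_leftRegular (orbitFun Γ x f) h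
      have h2 : lpTranslate h⁻¹ (orbitFun Γ x f) = orbitFun Γ x f' := by
        ext g
        rw [lpComp_apply, orbitFun_apply, orbitFun_apply, hf, inv_inv, mul_smul]
      -- Covariance: translating the function by `h` is conjugating its operator by `λ_h`, which a
      -- central state does not see.
      have h3 : mulOp (orbitFun Γ x f') =
          leftRegular h⁻¹ * (mulOp (orbitFun Γ x f) * leftRegular h) := by
        rw [h1, h2, ← mul_assoc, ← leftRegular_mul, inv_mul_cancel, leftRegular_one, one_mul]
      rw [hψ, hψ, h3, hcent _ (Λ.inv_mem hh), mul_assoc, ← leftRegular_mul, mul_inv_cancel,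
        leftRegular_one, mul_one]
  let Φ : CompactlySupportedContinuousMap X ℝ →ₚ[ℝ] ℝ :=
    { toFun := fun f => ψ f.toContinuousMap
      map_add' := fun f g => ψ.map_add f.toContinuousMap g.toContinuousMap
      map_smul' := fun c f => ψ.map_smul c f.toContinuousMap
      monotone' := fun f g hfg => by
        have h := hψpos (g.toContinuousMap - f.toContinuousMap) (sub_nonneg.2 hfg)
        rw [map_sub] at h
        exact sub_nonneg.1 h }
  let μ := RealRMK.rieszMeasure Φ
  have hμ : ∀ f : C(X, ℝ), ∫ y, f y ∂μ = ψ f := fun f =>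
    RealRMK.integral_rieszMeasure Φ ⟨f, HasCompactSupport.of_compactSpace f⟩
  have hμinv : ∀ h ∈ Λ, μ.map (fun y => h • y) = μ := fun h hh => by
    let e : X ≃ₜ X :=
      { toFun := fun y => h • y
        invFun := fun y => h⁻¹ • y
        left_inv := fun y => inv_smul_smul h y
        right_inv := fun y => smul_inv_smul h y
        continuous_toFun := hcont h
        continuous_invFun := hcont h⁻¹ }
    -- Regularity of the image measure lets integrals of continuous functions determine it.
    have hreg : (μ.map (fun y => h • y)).Regular := Measure.Regular.map e
    refine Measure.ext_of_integral_eq_on_compactlySupported fun f => ?_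
    rw [integral_map (hcont h).measurable.aemeasurable
      (map_continuous f).measurable.aestronglyMeasurable]
    let f' : C(X, ℝ) := ⟨fun y => f (h • y), (map_continuous f).comp (hcont h)⟩
    exact (hμ f').trans ((hψinv h hh f.toContinuousMap f' fun _ => rfl).trans
      (hμ f.toContinuousMap).symm)
  have hae := hinv μ inferInstance hμinv
  have hint : ∀ f : C(X, ℝ), ψ f = f x * μ.real Set.univ := fun f => by
    rw [← hμ, integral_congr_ae (g := fun _ => f x) (by
      filter_upwards [hae] with y hy
      rw [hy])]
    simp [mul_comm]
  -- The total mass is read off from the constant function `1`.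
  have h1 : μ.real Set.univ = 1 := by
    have h := hint 1
    have e : orbitFun Γ x (1 : C(X, ℝ)) = 1 := rfl
    rw [hψ, e, mulOp_one, hone] at h
    simpa using h.symm
  rw [← hψ, hint, h1, mul_one]

/-- If `Λ` is the stabilizer of a point `x`, at which every `Λ`-invariant measure is
concentrated, then every amenable subalgebra of `LΓ` that contains `LΛ` is contained in `LΛ`. -/
theorem le_groupVN_of_isAmenable {Λ : Subgroup Γ} {x : X}
    (hcont : ∀ g : Γ, Continuous fun y : X => g • y)
    (hinv : ∀ μ : Measure X, IsFiniteMeasure μ → (∀ h ∈ Λ, μ.map (fun y => h • y) = μ) →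
      ∀ᵐ y ∂μ, y = x)
    (hstab : ∀ g : Γ, g • x = x → g ∈ Λ) {A : VonNeumannAlgebra ℓ²(Γ, ℂ)}
    (hΛA : groupVN Λ ≤ A) (hA : A ≤ groupVN ⊤) (hamen : A.IsAmenable (dirac 1)) :
    A ≤ groupVN Λ := by
  obtain ⟨φ, hpos, hcent, htr⟩ := exists_central_state hA hamen
  have hone : φ 1 = 1 := by
    rw [htr 1 (one_mem _)]
    exact dirac_apply_self 1
  have hstate := state_orbitFun_eq hcont hinv φ hone hpos
    fun g hg T => hcent _ (hΛA (leftRegular_mem hg)) T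
  -- If `f(x) = 0` then `φ(f²) = 0`, so by Cauchy-Schwarz `φ` vanishes on every product with `f` as
  -- left or right factor.
  have hzero : ∀ f : C(X, ℝ), f x = 0 → ∀ T, φ (mulOp (orbitFun Γ x f) * T) = 0 ∧
      φ (T * mulOp (orbitFun Γ x f)) = 0 := fun f hf T => by
    have h0 : (φ (star (mulOp (orbitFun Γ x f)) * mulOp (orbitFun Γ x f))).re = 0 := by
      have e : orbitFun Γ x f * orbitFun Γ x f = orbitFun Γ x (f * f) := rfl
      rw [star_mulOp, ← mulOp_mul, e, hstate, ContinuousMap.mul_apply, hf, mul_zero]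
    have h1 := norm_sq_le_of_positive φ hpos (mulOp (orbitFun Γ x f)) T
    have h2 := norm_sq_le_of_positive φ hpos (star T) (mulOp (orbitFun Γ x f))
    rw [h0, zero_mul, star_mulOp] at h1
    rw [h0, mul_zero, star_star] at h2
    exact ⟨norm_eq_zero.1 (pow_eq_zero_iff two_ne_zero |>.1 (le_antisymm h1 (sq_nonneg _))),
      norm_eq_zero.1 (pow_eq_zero_iff two_ne_zero |>.1 (le_antisymm h2 (sq_nonneg _)))⟩
  intro a ha
  refine mem_groupVN_of_support (hA ha) fun g hg => ?_
  have hne : g⁻¹ • x ≠ x := fun h => hg (by simpa using Λ.inv_mem (hstab _ h))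
  obtain ⟨f, hf0, hf1, -⟩ := exists_continuous_zero_one_of_isClosed
    (isClosed_singleton (x := g⁻¹ • x)) (isClosed_singleton (x := x))
    (Set.disjoint_singleton.2 hne)
  have hf0 : f (g⁻¹ • x) = 0 := hf0 rfl
  have hf1 : f x = 1 := hf1 rfl
  let f' : C(X, ℝ) := ⟨fun y => f (g⁻¹ • y), f.continuous.comp (hcont _)⟩
  have h1 : mulOp (orbitFun Γ x f) * leftRegular g⁻¹ =
      leftRegular g⁻¹ * mulOp (orbitFun Γ x f') := by
    rw [mulOp_mul_leftRegular]
    congr 2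
    ext h
    rw [lpComp_apply, orbitFun_apply, orbitFun_apply, inv_inv, mul_smul]
    rfl
  have h2 : φ (leftRegular g⁻¹ * a) = 0 := by
    -- Split `1 = (1 - f) + f`. The first part is killed on the left because `1 - f` vanishes at
    -- `x`. In the second, `f` moves past `λ_g⁻¹` to become `f'`, and centrality of `a` brings `f'`
    -- to the right end, where it is killed because `f'(x) = f(g⁻¹x) = 0`.
    have e : leftRegular g⁻¹ * a = mulOp (orbitFun Γ x (1 - f)) * (leftRegular g⁻¹ * a) +
        mulOp (orbitFun Γ x f) * (leftRegular g⁻¹ * a) := by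
      rw [← add_mul, ← map_add, ← map_add, sub_add_cancel]
      change _ = mulOp 1 * _
      rw [mulOp_one, one_mul]
    rw [e, map_add, (hzero (1 - f) (by simp [hf1]) _).1, zero_add, ← mul_assoc, h1,
      ← hcent a ha, ← mul_assoc]
    exact (hzero f' hf0 _).2
  rw [htr _ (mul_mem (leftRegular_mem (Subgroup.mem_top _)) (hA ha)), mul_apply_eq_comp,
    leftRegular_apply, inv_inv, mul_one] at h2
  exact h2

end MaximalAmenable

/-! ### Amenability of `LΛ` from an invariant mean -/

section AmenableGroupVN

open VonNeumannAlgebra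

variable {Γ : Type*} [Group Γ]

/-- The Fourier coefficients of an element of `LΛ` are supported on `Λ`. -/
theorem groupVN_apply_eq_zero {Λ : Subgroup Γ} {a : ℓ²(Γ, ℂ) →L[ℂ] ℓ²(Γ, ℂ)} (ha : a ∈ groupVN Λ)
    {g : Γ} (hg : g ∉ Λ) : a (dirac 1) g = 0 := by
  classical
  -- The indicator function of `Λ` is invariant under left translation by `Λ`, so it commutes with
  -- `LΛ`, and it fixes `δ₁`.
  let f : lp (fun _ : Γ => ℝ) ⊤ := ⟨fun x => if x ∈ Λ then 1 else 0, memℓp_infty ⟨1, by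
    rintro _ ⟨x, rfl⟩
    dsimp only
    split_ifs <;> simp⟩⟩
  have hf : ∀ x, f x = if x ∈ Λ then 1 else 0 := fun x => rfl
  have hcomm := mem_groupVN_iff.1 ha (mulOp f) fun h hh => by
    rw [mulOp_mul_leftRegular]
    congr 2
    ext x
    rw [lpComp_apply, hf, hf, inv_inv, Λ.mul_mem_cancel_left hh]
  have h1 : mulOp f (dirac 1) = dirac 1 := by
    ext x
    rw [mulOp_apply]
    by_cases hx : x = 1
    · subst hx
      rw [hf, if_pos Λ.one_mem, Complex.ofReal_one, one_mul]
    · rw [dirac_apply_ne hx, mul_zero]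
  have h2 := DFunLike.congr_fun hcomm (dirac 1)
  rw [mul_apply_eq_comp, mul_apply_eq_comp, h1] at h2
  rw [← h2, mulOp_apply, hf, if_neg hg, Complex.ofReal_zero, zero_mul]

theorem star_compress {H : Type*} [NormedAddCommGroup H] [InnerProductSpace ℂ H] [CompleteSpace H]
    (K : Submodule ℂ H) [K.HasOrthogonalProjection] [CompleteSpace K] (T : H →L[ℂ] H) :
    star (compress K T) = compress K (star T) := by
  refine ContinuousLinearMap.ext fun v => ext_inner_left ℂ fun w => ?_
  rw [← inner_apply_left, Submodule.coe_inner, Submodule.coe_inner, coe_compress_apply,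
    coe_compress_apply, Submodule.inner_starProjection_left_eq_right,
    Submodule.starProjection_eq_self_iff.2 v.2, ← Submodule.inner_starProjection_left_eq_right,
    Submodule.starProjection_eq_self_iff.2 w.2, inner_apply_left]

section MeanState

variable {α K : Type*} [NormedAddCommGroup K] [InnerProductSpace ℂ K]

/-- The real parts of the diagonal entries `⟨T e_i, e_i⟩` of an operator. -/
def diagFun (e : α → K) (he : ∀ i, ‖e i‖ = 1) :
    (K →L[ℂ] K) →ₗ[ℝ] lp (fun _ : α => ℝ) ⊤ where
  toFun T := ⟨fun i => (inner ℂ (e i) (T (e i))).re, memℓp_infty ⟨‖T‖, by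
    rintro _ ⟨i, rfl⟩
    refine (Complex.abs_re_le_norm _).trans ((norm_inner_le_norm _ _).trans ?_)
    have := T.le_opNorm (e i)
    rwa [he, mul_one, ← one_mul ‖T (e i)‖, ← he i] at this⟩⟩
  map_add' S T := by
    ext i
    change (inner ℂ (e i) (S (e i) + T (e i))).re = _
    rw [inner_add_right]
    rfl
  map_smul' c T := by
    ext i
    change (inner ℂ (e i) (c • T (e i))).re = c * _
    rw [← Complex.coe_smul, inner_smul_right, Complex.re_ofReal_mul]

theorem diagFun_apply (e : α → K) (he : ∀ i, ‖e i‖ = 1) (T : K →L[ℂ] K) (i : α) :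
    diagFun e he T i = (inner ℂ (e i) (T (e i))).re := rfl

/-- The state `T ↦ m (i ↦ ⟨T e_i, e_i⟩)` on `B(K)`, for a mean `m` and unit vectors `e_i`. -/
def meanState (m : lp (fun _ : α => ℝ) ⊤ →ₗ[ℝ] ℝ) (e : α → K) (he : ∀ i, ‖e i‖ = 1) :
    (K →L[ℂ] K) →ₗ[ℂ] ℂ :=
  Module.Dual.extendRCLike (m ∘ₗ diagFun e he)

theorem meanState_apply (m : lp (fun _ : α => ℝ) ⊤ →ₗ[ℝ] ℝ) (e : α → K) (he : ∀ i, ‖e i‖ = 1)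
    (T : K →L[ℂ] K) : meanState m e he T =
      m (diagFun e he T) - Complex.I * m (diagFun e he (Complex.I • T)) := rfl

theorem meanState_eq_of_const {m : lp (fun _ : α => ℝ) ⊤ →ₗ[ℝ] ℝ} (hm : IsMean m) (e : α → K)
    (he : ∀ i, ‖e i‖ = 1) {T : K →L[ℂ] K} {c : ℂ} (h : ∀ i, inner ℂ (e i) (T (e i)) = c) :
    meanState m e he T = c := by
  have h1 : diagFun e he T = c.re • 1 := by
    ext i
    rw [diagFun_apply, h]
    simp
  have h2 : diagFun e he (Complex.I • T) = (-c.im) • 1 := by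
    ext i
    rw [diagFun_apply, _root_.smul_apply, inner_smul_right, h, Complex.I_mul_re]
    exact (mul_one _).symm
  rw [meanState_apply, h1, h2, map_smul, map_smul, hm.1]
  apply Complex.ext <;> simp

theorem meanState_star_mul_self_nonneg [CompleteSpace K]
    {m : lp (fun _ : α => ℝ) ⊤ →ₗ[ℝ] ℝ} (hm : IsMean m)
    (e : α → K) (he : ∀ i, ‖e i‖ = 1) (T : K →L[ℂ] K) : 0 ≤ meanState m e he (star T * T) := by
  have h : ∀ i, inner ℂ (e i) ((star T * T) (e i)) = ((‖T (e i)‖ ^ 2 : ℝ) : ℂ) := fun i => by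
    rw [mul_apply_eq_comp, ← inner_apply_left, inner_self_eq_norm_sq_to_K]
    push_cast
    rfl
  have h1 : 0 ≤ m (diagFun e he (star T * T)) := hm.2 _ fun i => by
    rw [diagFun_apply, h, Complex.ofReal_re]
    positivity
  have h2 : diagFun e he (Complex.I • (star T * T)) = 0 := by
    ext i
    rw [diagFun_apply, _root_.smul_apply, inner_smul_right, h, Complex.I_mul_re,
      Complex.ofReal_im, neg_zero]
    rfl
  rw [meanState_apply, h2, map_zero, Complex.ofReal_zero, mul_zero, sub_zero]
  exact_mod_cast h1

/-- Transfers invariance of the mean under a relabelling of the vectors to the state. -/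
theorem meanState_congr {m : lp (fun _ : α => ℝ) ⊤ →ₗ[ℝ] ℝ} (σ : α → α)
    (hm : ∀ f, m (lpComp σ f) = m f) (e : α → K)
    (he : ∀ i, ‖e i‖ = 1) {T T' : K →L[ℂ] K}
    (h : ∀ i, inner ℂ (e i) (T' (e i)) = inner ℂ (e (σ i)) (T (e (σ i)))) :
    meanState m e he T' = meanState m e he T := by
  have key : ∀ c : ℂ, m (diagFun e he (c • T')) = m (diagFun e he (c • T)) := fun c => by
    rw [← hm (diagFun e he (c • T))]
    congr 1
    ext i
    rw [lpComp_apply, diagFun_apply, diagFun_apply, _root_.smul_apply,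
      _root_.smul_apply, inner_smul_right, inner_smul_right, h]
  have h1 := key 1
  rw [one_smul, one_smul] at h1
  rw [meanState_apply, meanState_apply, h1, key]

end MeanState

theorem norm_star_dirac_one {Λ : Subgroup Γ} {a : ℓ²(Γ, ℂ) →L[ℂ] ℓ²(Γ, ℂ)}
    (ha : a ∈ groupVN Λ) : ‖star a (dirac 1)‖ = ‖a (dirac 1)‖ := by
  rw [← conjugation_apply_dirac_one ha, LinearIsometry.norm_map]

section CentralElements

variable {E : Type*} [NormedAddCommGroup E] [InnerProductSpace ℂ E]

/-- The elements that are central for a positive functional form a closed set in the 2-norm. -/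
theorem central_of_tendsto [CompleteSpace E] (φ : (E →L[ℂ] E) →ₗ[ℂ] ℂ)
    (hpos : ∀ T, 0 ≤ φ (star T * T)) {ι : Type*} {l : Filter ι} [l.NeBot] {a : E →L[ℂ] E}
    {s : ι → E →L[ℂ] E} (h : Tendsto (fun i => √(φ (star (a - s i) * (a - s i))).re) l (𝓝 0))
    (h' : Tendsto (fun i => √(φ ((a - s i) * star (a - s i))).re) l (𝓝 0)) (T : E →L[ℂ] E)
    (hc : ∀ i, φ (s i * T) = φ (T * s i)) : φ (a * T) = φ (T * a) := by
  have hcs1 : ∀ b, ‖φ (b * T)‖ ≤ √(φ (b * star b)).re * √(φ (star T * T)).re := fun b => by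
    simpa only [star_star] using norm_le_of_positive φ hpos (star b) T
  have hcs2 : ∀ b, ‖φ (T * b)‖ ≤ √(φ (T * star T)).re * √(φ (star b * b)).re := fun b => by
    simpa only [star_star] using norm_le_of_positive φ hpos (star T) b
  rw [← sub_eq_zero, ← norm_eq_zero]
  refine le_antisymm ?_ (norm_nonneg _)
  have hlim := (h'.mul_const (√(φ (star T * T)).re)).add (h.const_mul (√(φ (T * star T)).re))
  rw [zero_mul, mul_zero, add_zero] at hlim
  refine ge_of_tendsto hlim (Eventually.of_forall fun i => ?_)
  have e : φ (a * T) - φ (T * a) = φ ((a - s i) * T) - φ (T * (a - s i)) := by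
    rw [sub_mul, mul_sub, map_sub, map_sub, hc]
    ring
  rw [e]
  exact (norm_sub_le _ _).trans (add_le_add (hcs1 _) (hcs2 _))

theorem central_of_mem_span (φ : (E →L[ℂ] E) →ₗ[ℂ] ℂ) {S : Set (E →L[ℂ] E)} (T : E →L[ℂ] E)
    (hS : ∀ x ∈ S, φ (x * T) = φ (T * x)) {x : E →L[ℂ] E} (hx : x ∈ Submodule.span ℂ S) :
    φ (x * T) = φ (T * x) := by
  induction hx using Submodule.span_induction with
  | mem x hx => exact hS x hx
  | zero => rw [zero_mul, mul_zero]
  | add x y _ _ hx hy => rw [add_mul, mul_add, map_add, map_add, hx, hy]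
  | smul c x _ hx => rw [smul_mul_assoc, mul_smul_comm, map_smul, map_smul, hx]

end CentralElements

/-- An element of `LΛ` is the limit of finite combinations of translations. -/
theorem groupVN_hasSum {Λ : Subgroup Γ} {a : ℓ²(Γ, ℂ) →L[ℂ] ℓ²(Γ, ℂ)} (ha : a ∈ groupVN Λ) :
    ∃ s : Finset Γ → (ℓ²(Γ, ℂ) →L[ℂ] ℓ²(Γ, ℂ)),
      (∀ F, s F ∈ Submodule.span ℂ (leftRegular '' (Λ : Set Γ))) ∧
      Tendsto (fun F => s F (dirac 1)) atTop (𝓝 (a (dirac 1))) := by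
  refine ⟨fun F => ∑ g ∈ F, a (dirac 1) g • leftRegular g, fun F =>
    Submodule.sum_mem _ fun g _ => ?_, ?_⟩
  · by_cases hg : g ∈ Λ
    · exact Submodule.smul_mem _ _ (Submodule.subset_span ⟨g, hg, rfl⟩)
    · rw [groupVN_apply_eq_zero ha hg, zero_smul]
      exact Submodule.zero_mem _
  · refine (hasSum_dirac (a (dirac 1))).congr fun F => ?_
    rw [_root_.sum_apply]
    refine Finset.sum_congr rfl fun g _ => ?_
    rw [_root_.smul_apply, leftRegular_dirac, mul_one]

/-- A hypertrace for a representation of `LΛ` on a Hilbert space with a basis permuted by `Λ`. -/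
theorem exists_hypertrace {E : Type*} [NormedAddCommGroup E] [InnerProductSpace ℂ E]
    [CompleteSpace E] {Λ : Subgroup Γ} (hΛ : IsAmenableGroup Λ) (e : Λ → E) (he : ∀ h, ‖e h‖ = 1)
    (c : (ℓ²(Γ, ℂ) →L[ℂ] ℓ²(Γ, ℂ)) →ₗ[ℂ] (E →L[ℂ] E)) (hone : c 1 = 1)
    (hstar : ∀ T, star (c T) = c (star T))
    (hmul : ∀ T, ∀ a ∈ groupVN Λ, c (T * a) = c T * c a)
    (hval : ∀ γ h : Λ, c (leftRegular (γ : Γ)) (e h) = e (γ * h))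
    (hdiag : ∀ a ∈ groupVN Λ, ∀ h, inner ℂ (e h) (c a (e h)) = inner ℂ (dirac 1) (a (dirac 1))) :
    ∃ φ : (E →L[ℂ] E) →ₗ[ℂ] ℂ, φ 1 = 1 ∧ (∀ T, 0 ≤ φ (star T * T)) ∧
      (∀ a ∈ groupVN Λ, ∀ T, φ (c a * T) = φ (T * c a)) ∧
      ∀ a ∈ groupVN Λ, φ (c a) = inner ℂ (dirac 1) (a (dirac 1)) := by
  obtain ⟨m, hm, hinv⟩ := isAmenableGroup_iff.1 hΛ
  have hpos := meanState_star_mul_self_nonneg hm e he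
  have htr : ∀ a ∈ groupVN Λ, meanState m e he (c a) = inner ℂ (dirac 1) (a (dirac 1)) :=
    fun a ha => meanState_eq_of_const hm e he (hdiag a ha)
  -- Centrality for a translation: both products have the same diagonal entries up to the shift `h ↦
  -- γ⁻¹h`, and the mean is invariant under it.
  have hreg : ∀ γ : Λ, ∀ T, meanState m e he (c (leftRegular (γ : Γ)) * T) =
      meanState m e he (T * c (leftRegular (γ : Γ))) := fun γ T => by
    refine meanState_congr (fun h => γ⁻¹ * h) (fun f => hinv γ f) e he fun h => ?_
    have h2 : star (c (leftRegular (γ : Γ))) (e h) = e (γ⁻¹ * h) := by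
      rw [hstar, star_leftRegular]
      exact hval γ⁻¹ h
    rw [mul_apply_eq_comp, mul_apply_eq_comp, inner_apply_right, hval, h2, mul_inv_cancel_left]
  -- On `LΛ` the seminorms of the state are the 2-norm, because the state restricts to the trace.
  -- Centrality therefore passes from combinations of translations to their 2-norm limits.
  have hsq : ∀ b ∈ groupVN Λ, √(meanState m e he (star (c b) * c b)).re = ‖b (dirac 1)‖ :=
    fun b hb => by
      rw [hstar, ← hmul _ _ hb, htr _ (mul_mem (star_mem hb) hb), mul_apply_eq_comp,
        ← inner_apply_left]
      exact (norm_eq_sqrt_re_inner (𝕜 := ℂ) _).symm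
  have hsq' : ∀ b ∈ groupVN Λ, √(meanState m e he (c b * star (c b))).re = ‖b (dirac 1)‖ :=
    fun b hb => by
      have h := hsq _ (star_mem hb)
      rwa [norm_star_dirac_one hb, hstar, star_star, ← hstar] at h
  refine ⟨meanState m e he, ?_, hpos, fun a ha T => ?_, htr⟩
  · rw [← hone, htr _ (one_mem _), inner_dirac_left]
    exact dirac_apply_self 1
  · obtain ⟨s, hs, hlim⟩ := groupVN_hasSum ha
    have hs' : ∀ F, s F ∈ groupVN Λ := fun F => by
      refine Submodule.span_le (p := (groupVN Λ).toSubalgebra.toSubmodule).2 ?_ (hs F)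
      rintro _ ⟨g, hg, rfl⟩
      exact leftRegular_mem hg
    have h0 : Tendsto (fun F => ‖(a - s F) (dirac 1)‖) atTop (𝓝 0) := by
      have := (tendsto_const_nhds (x := a (dirac 1))).sub hlim
      rw [sub_self] at this
      exact tendsto_zero_iff_norm_tendsto_zero.1 this
    refine central_of_tendsto (meanState m e he) hpos (s := fun F => c (s F)) (l := atTop)
      ?_ ?_ T fun F => ?_
    · convert h0 using 2 with F
      rw [← map_sub]
      exact hsq _ (sub_mem ha (hs' F))
    · convert h0 using 2 with F
      rw [← map_sub]
      exact hsq' _ (sub_mem ha (hs' F))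
    · refine central_of_mem_span (meanState m e he) (S := c '' (leftRegular '' (Λ : Set Γ))) T
        ?_ ?_
      · rintro _ ⟨_, ⟨g, hg, rfl⟩, rfl⟩
        exact hreg ⟨g, hg⟩ T
      · rw [Submodule.span_image]
        exact Submodule.mem_map_of_mem (hs F)

/-- The group von Neumann algebra of an amenable group is amenable. -/
theorem isAmenable_groupVN {Λ : Subgroup Γ} (hΛ : IsAmenableGroup Λ) :
    (groupVN Λ).IsAmenable (dirac 1) := by
  let e : Λ → (groupVN Λ).L2 (dirac 1) := fun h => ⟨dirac (h : Γ), by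
    have := (groupVN Λ).apply_vector_mem_L2 (dirac 1) (leftRegular_mem h.2)
    rwa [leftRegular_dirac, mul_one] at this⟩
  obtain ⟨φ, h1, hpos, hc, htr⟩ := exists_hypertrace hΛ e (fun h => norm_dirac (h : Γ))
    (compress ((groupVN Λ).L2 (dirac 1))) (compress_one _) (star_compress _)
    (fun T a ha => compress_mul_right _ (fun v hv => (groupVN Λ).apply_mem_L2 _ ha hv) T)
    (fun γ h => by
      refine Subtype.ext ?_
      rw [coe_compress_apply, Submodule.starProjection_eq_self_iff.2
        ((groupVN Λ).apply_mem_L2 _ (leftRegular_mem γ.2) (e _).2)]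
      exact leftRegular_dirac (γ : Γ) (h : Γ))
    (fun a ha h => by
      rw [Submodule.coe_inner, coe_compress_apply,
        ← Submodule.inner_starProjection_left_eq_right,
        Submodule.starProjection_eq_self_iff.2 (e h).2]
      change inner ℂ (dirac (h : Γ)) (a (dirac (h : Γ))) = _
      rw [inner_dirac_left, inner_dirac_left, groupVN_dirac_apply ha, mul_inv_cancel])
  refine ⟨φ, h1, hpos, fun a T => ?_, fun a => ?_⟩
  · rw [leftMul_eq_compress]
    exact hc a a.2 T
  · rw [leftMul_eq_compress]
    exact htr a a.2

end AmenableGroupVN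

/-! ## Diffuse centers -/

namespace VonNeumannAlgebra

section Minimal

variable {H : Type*} [NormedAddCommGroup H] [InnerProductSpace ℂ H] [CompleteSpace H]

/-- The projection onto the closure of the range of a self-adjoint element. -/
theorem exists_range_projection (A : VonNeumannAlgebra H) {b : H →L[ℂ] H} (hb : b ∈ A) :
    ∃ q ∈ A, IsStarProjection q ∧ q * b = b ∧
      ∀ S : H →L[ℂ] H, S * b = 0 → S * q = 0 := by
  let K : Submodule ℂ H := b.toLinearMap.range.topologicalClosure
  have hK : IsClosed (K : Set H) := Submodule.isClosed_topologicalClosure _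
  have : CompleteSpace K := hK.completeSpace_coe
  have hle : ∀ v, b v ∈ K := fun v => Submodule.le_topologicalClosure _ ⟨v, rfl⟩
  have hind : ∀ s : Set H, IsClosed s → (∀ v, b v ∈ s) → ∀ v ∈ K, v ∈ s := fun s hs h v hv =>
    closure_minimal (t := s) (by rintro _ ⟨v, rfl⟩; exact h v) hs hv
  have hinv : ∀ g ∈ A.commutant, ∀ v ∈ K, g v ∈ K := fun g hg v hv =>
    hind (g ⁻¹' K) (hK.preimage g.continuous) (fun v => by
      have h := DFunLike.congr_fun (mem_commutant_iff.1 hg b hb) v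
      rw [mul_apply_eq_comp, mul_apply_eq_comp] at h
      change g (b v) ∈ K
      rw [← h]
      exact hle _) v hv
  refine ⟨K.starProjection, ?_, isStarProjection_starProjection, ?_, fun S hS => ?_⟩
  · rw [← A.commutant_commutant, mem_commutant_iff]
    intro g hg
    ext v
    exact (K.starProjection_apply_comm (hinv g hg) (hinv _ (star_mem hg)) v).symm
  · ext v
    exact Submodule.starProjection_eq_self_iff.2 (hle v)
  · ext v
    exact hind {w | S w = 0} (isClosed_eq S.continuous continuous_const)
      (fun v => DFunLike.congr_fun hS v) _ (K.starProjection_apply_mem v)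

/-- A self-adjoint element below a minimal projection of a commutative von Neumann algebra is
semidefinite. -/
theorem semidefinite_of_minimal (A : VonNeumannAlgebra H) (hA : ∀ a ∈ A, ∀ b ∈ A, a * b = b * a)
    {p : H →L[ℂ] H} (hp : p ∈ A) (hmin : ∀ q ∈ A, IsStarProjection q → p * q = q → q = 0 ∨ q = p)
    {y : H →L[ℂ] H} (hy : y ∈ A) (hsa : star y = y) (hyp : y * p = y) :
    (∀ v, 0 ≤ (inner ℂ (y v) v).re) ∨ ∀ v, (inner ℂ (y v) v).re ≤ 0 := by
  obtain ⟨R, hR, hRsa, hRpos, hnorm⟩ := A.exists_modulus hy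
  have hRR : R * R = y * y := by
    refine ContinuousLinearMap.coe_inj.1 ((ext_inner_map _ _).1 fun v => ?_)
    change inner ℂ (R (R v)) v = inner ℂ (y (y v)) v
    rw [inner_apply_left R, inner_apply_left y, hRsa, hsa, inner_self_eq_norm_sq_to_K,
      inner_self_eq_norm_sq_to_K, hnorm]
  have hRp : p * R = R := by
    rw [hA p hp R hR]
    ext v
    rw [mul_apply_eq_comp, ← sub_eq_zero, ← map_sub, ← norm_eq_zero, hnorm, norm_eq_zero, map_sub,
      sub_eq_zero]
    exact DFunLike.congr_fun hyp v
  have hpy : p * y = y := by rw [hA p hp y hy, hyp]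
  -- With `R = |y|` one has `(R - y)(R + y) = 0`. The range projection `q` of `R + y` lies below
  -- `p`, so it is `0` or `p`, and accordingly `y = -R` or `y = R`.
  obtain ⟨q, hq, hqp, hqb, hqS⟩ := A.exists_range_projection (add_mem hR hy)
  have hpq : p * q = q := by
    have := hqS (p - 1) (by rw [sub_mul, mul_add, hRp, hpy, one_mul, sub_self])
    rwa [sub_mul, one_mul, sub_eq_zero] at this
  rcases hmin q hq hqp hpq with h0 | h0
  · right
    intro v
    have h1 : y = -R := by
      rw [h0, zero_mul] at hqb
      exact (neg_eq_of_add_eq_zero_right hqb.symm).symm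
    rw [h1, neg_apply, inner_neg_left, Complex.neg_re]
    exact neg_nonpos.2 (hRpos v)
  · left
    have h1 : (R - y) * q = 0 := hqS _ (by
      rw [sub_mul, mul_add, mul_add, hRR, hA R hR y hy]
      abel)
    have h2 : R = y := by
      rwa [h0, sub_mul, hA R hR p hp, hRp, hyp, sub_eq_zero] at h1
    rw [← h2]
    exact hRpos

/-- A self-adjoint element is scalar on a minimal projection of a commutative von Neumann
algebra. -/
theorem exists_apply_eq_smul_of_minimal (A : VonNeumannAlgebra H)
    (hA : ∀ a ∈ A, ∀ b ∈ A, a * b = b * a) {p : H →L[ℂ] H} (hp : p ∈ A)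
    (hproj : IsStarProjection p) (hp0 : p ≠ 0)
    (hmin : ∀ q ∈ A, IsStarProjection q → p * q = q → q = 0 ∨ q = p)
    {x : H →L[ℂ] H} (hx : x ∈ A) (hsa : star x = x) :
    ∃ v ≠ 0, ∃ c : ℂ, x v = c • v := by
  have hpsa : star p = p := hproj.isSelfAdjoint.star_eq
  have hpp : p * p = p := hproj.isIdempotentElem
  let y : ℝ → H →L[ℂ] H := fun c => (x - (c : ℂ) • 1) * p
  have hy : ∀ c, y c ∈ A := fun c =>
    mul_mem (sub_mem hx (A.toSubalgebra.toSubmodule.smul_mem _ (one_mem A))) hp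
  have hysa : ∀ c, star (y c) = y c := fun c => by
    have h1 : star (x - (c : ℂ) • (1 : H →L[ℂ] H)) = x - (c : ℂ) • 1 := by
      rw [star_sub, star_smul, star_one, hsa, Complex.star_def, Complex.conj_ofReal]
    rw [star_mul, h1, hpsa]
    exact hA p hp _ (sub_mem hx (A.toSubalgebra.toSubmodule.smul_mem _ (one_mem A)))
  have hyp : ∀ c, y c * p = y c := fun c => by rw [mul_assoc, hpp]
  have hyv : ∀ c v, p v = v → (inner ℂ (y c v) v).re = (inner ℂ (x v) v).re - c * ‖v‖ ^ 2 :=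
    fun c v hv => by
      have : y c v = x v - (c : ℂ) • v := by
        change x (p v) - (c : ℂ) • p v = _
        rw [hv]
      rw [this, inner_sub_left, inner_smul_left, inner_self_eq_norm_sq_to_K, Complex.conj_ofReal,
        Complex.sub_re, Complex.re_ofReal_mul]
      norm_cast
  obtain ⟨w, hw⟩ : ∃ w, p w ≠ 0 := by
    by_contra! h
    exact hp0 (ContinuousLinearMap.ext h)
  have hpp' : ∀ v, p (p v) = p v := fun v => DFunLike.congr_fun hpp v
  -- The Rayleigh quotient of `x` is constant on the range of `p`: a number `c` strictly between two
  -- of its values would make `(x - c)p` indefinite.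
  let ρ : H → ℝ := fun v => (inner ℂ (x v) v).re / ‖v‖ ^ 2
  have hρ : ∀ v, v ≠ 0 → (inner ℂ (x v) v).re = ρ v * ‖v‖ ^ 2 := fun v hv =>
    (div_mul_cancel₀ _ (by positivity)).symm
  have hle : ∀ u v, p u = u → p v = v → u ≠ 0 → v ≠ 0 → ρ v ≤ ρ u := fun u v hu hv hu0 hv0 => by
    by_contra! hlt
    obtain ⟨c, hc1, hc2⟩ := exists_between hlt
    have h1 : (inner ℂ (y c u) u).re < 0 := by
      rw [hyv c u hu, hρ u hu0, ← sub_mul]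
      exact mul_neg_of_neg_of_pos (sub_neg.2 hc1) (by positivity)
    have h2 : 0 < (inner ℂ (y c v) v).re := by
      rw [hyv c v hv, hρ v hv0, ← sub_mul]
      exact mul_pos (sub_pos.2 hc2) (by positivity)
    rcases A.semidefinite_of_minimal hA hp hmin (hy c) (hysa c) (hyp c) with h | h
    · exact (h u).not_gt h1
    · exact (h v).not_gt h2
  -- The quadratic form of `(x - ρ)p` vanishes on the range of `p`, hence everywhere, and over `ℂ`
  -- this forces the operator to vanish.
  have hzero : y (ρ (p w)) = 0 := by
    refine ContinuousLinearMap.coe_inj.1 ((inner_map_self_eq_zero _).1 fun v => ?_)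
    change inner ℂ (y _ v) v = 0
    have him : (inner ℂ (y (ρ (p w)) v) v).im = 0 := by
      rw [← Complex.conj_eq_iff_im, inner_conj_symm, inner_apply_left, hysa]
    have hre : (inner ℂ (y (ρ (p w)) v) v).re = (inner ℂ (y (ρ (p w)) (p v)) (p v)).re := by
      have h1 : y (ρ (p w)) (p v) = y (ρ (p w)) v := DFunLike.congr_fun (hyp _) v
      rw [h1, inner_apply_left _ v (p v), hysa, h1, ← hysa, ← inner_apply_left, hysa]
    refine Complex.ext ?_ him
    rw [hre, hyv _ _ (hpp' v)]
    by_cases hv : p v = 0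
    · simp [hv]
    · rw [hρ _ hv, le_antisymm (hle _ _ (hpp' w) (hpp' v) hw hv) (hle _ _ (hpp' v) (hpp' w) hv hw),
        sub_self]
      rfl
  refine ⟨p w, hw, (ρ (p w) : ℂ), ?_⟩
  have h := DFunLike.congr_fun hzero (p w)
  change x (p (p w)) - (ρ (p w) : ℂ) • p (p w) = 0 at h
  rwa [hpp', sub_eq_zero] at h

end Minimal

end VonNeumannAlgebra

/-! ### Two-sided linear recurrences -/

section Recurrence

theorem eq_zero_of_norm_le_succ {b : ℤ → ℂ} (hb : Tendsto b cofinite (𝓝 0))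
    (h : ∀ k, ‖b k‖ ≤ ‖b (k + 1)‖) (k : ℤ) : b k = 0 := by
  have hle : ∀ n : ℕ, ‖b k‖ ≤ ‖b (k + n)‖ := fun n => by
    induction n with
    | zero => simp
    | succ n ih =>
      push_cast
      rw [← add_assoc]
      exact ih.trans (h _)
  have hinj : Function.Injective fun n : ℕ => k + (n : ℤ) := fun m n hmn => by
    simpa using hmn
  have hlim := (hb.comp hinj.tendsto_cofinite).norm
  rw [Nat.cofinite_eq_atTop, norm_zero] at hlim
  exact norm_eq_zero.1 (le_antisymm (ge_of_tendsto' hlim hle) (norm_nonneg _))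

theorem eq_zero_of_geometric {b : ℤ → ℂ} (hb : Tendsto b cofinite (𝓝 0)) {t : ℂ}
    (h : ∀ k, b (k + 1) = t * b k) (k : ℤ) : b k = 0 := by
  rcases le_total 1 ‖t‖ with h1 | h1
  · refine eq_zero_of_norm_le_succ hb (fun k => ?_) k
    rw [h, norm_mul]
    exact le_mul_of_one_le_left (norm_nonneg _) h1
  -- For `‖t‖ ≤ 1` the norms grow towards `-∞`, so the sequence is reversed.
  · have := eq_zero_of_norm_le_succ (b := fun k => b (-k))
      (hb.comp neg_injective.tendsto_cofinite) (fun k => by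
        have := h (-(k + 1))
        rw [neg_add, neg_add_cancel_right, ← neg_add] at this
        rw [this, norm_mul]
        exact mul_le_of_le_one_left (norm_nonneg _) h1) (-k)
    simpa using this

/-- A square summable sequence has no eigenvectors under `a ↦ (k ↦ a (k - 1) + a (k + 1))`. -/
theorem eq_zero_of_recurrence {a : ℤ → ℂ} (ha : Tendsto a cofinite (𝓝 0)) {c : ℂ}
    (h : ∀ k, a k + a (k + 1 + 1) = c * a (k + 1)) (k : ℤ) : a k = 0 := by
  obtain ⟨s, hs⟩ := IsAlgClosed.exists_eq_mul_self (c ^ 2 - 4)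
  -- A root `r` of `r² - cr + 1`, with other root `c - r`. Then `a (k + 1) - r * a k` is geometric
  -- of ratio `c - r`; once it vanishes, `a` is geometric of ratio `r`.
  obtain ⟨r, hr⟩ : ∃ r, r * (c - r) = 1 := ⟨(c + s) / 2, by linear_combination hs / 4⟩
  have hsucc : Tendsto (fun k => a (k + 1)) cofinite (𝓝 0) :=
    ha.comp (add_left_injective (1 : ℤ)).tendsto_cofinite
  have hb : Tendsto (fun k => a (k + 1) - r * a k) cofinite (𝓝 0) := by
    simpa using hsucc.sub (ha.const_mul r)
  refine eq_zero_of_geometric ha (fun k => sub_eq_zero.1 (eq_zero_of_geometric hb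
    (t := c - r) (fun k => ?_) k)) k
  linear_combination h k + a k * hr

end Recurrence

theorem tendsto_cofinite_of_lp {α : Type*} (f : ℓ²(α, ℂ)) : Tendsto f cofinite (𝓝 0) := by
  have h := ((memℓp_gen_iff (by norm_num)).1 (lp.memℓp f)).tendsto_cofinite_zero
  rw [tendsto_zero_iff_norm_tendsto_zero]
  have h2 := h.rpow_const (p := 1 / 2) (Or.inr (by norm_num))
  rw [Real.zero_rpow (by norm_num)] at h2
  refine h2.congr fun g => ?_
  rw [← Real.rpow_mul (norm_nonneg _)]
  norm_num

/-! ### Central elements of `LΛ` without eigenvectors -/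

section GroupVNCenter

open VonNeumannAlgebra

variable {Γ : Type*} [Group Γ]

/-- The operator `λ_z + λ_z⁻¹` has no eigenvectors if `z` has infinite order. -/
theorem eq_zero_of_leftRegular_add_eq_smul {z : Γ} (hz : ¬ IsOfFinOrder z) {f : ℓ²(Γ, ℂ)} {c : ℂ}
    (h : (leftRegular z + leftRegular z⁻¹) f = c • f) : f = 0 := by
  ext g
  have hinj : Function.Injective fun k : ℤ => z ^ k * g :=
    (mul_left_injective g).comp (injective_zpow_iff_not_isOfFinOrder.2 hz)
  -- Restrict `f` to the coset `⟨z⟩g`, which is a copy of `ℤ` because `z` has infinite order.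
  have := eq_zero_of_recurrence ((tendsto_cofinite_of_lp f).comp hinj.tendsto_cofinite) (c := c)
    (fun k => ?_) 0
  · simpa using this
  · have hk : leftRegular z f (z ^ (k + 1) * g) + leftRegular z⁻¹ f (z ^ (k + 1) * g) =
        c * f (z ^ (k + 1) * g) := congrArg (fun u : ℓ²(Γ, ℂ) => u (z ^ (k + 1) * g)) h
    rw [leftRegular_apply, leftRegular_apply, inv_inv, ← mul_assoc, ← mul_assoc, ← zpow_one_add,
      ← zpow_neg_one, ← zpow_add] at hk
    simp only [Function.comp_apply]
    convert hk using 5 <;> ring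

/-- The center of `LΛ` is diffuse if `Λ` has an element of infinite order which is normalized up
to inversion. -/
theorem isDiffuse_center_groupVN {Λ : Subgroup Γ} {z : Γ} (hzΛ : z ∈ Λ) (hz : ¬ IsOfFinOrder z)
    (hconj : ∀ h ∈ Λ, h * z = z * h ∨ h * z = z⁻¹ * h) : (groupVN Λ).center.IsDiffuse := by
  set x := leftRegular z + leftRegular z⁻¹ with hx
  have hsa : star x = x := by
    rw [hx, star_add, star_leftRegular, star_leftRegular, inv_inv, add_comm]
  have hcomm : ∀ h ∈ Λ, leftRegular h * x = x * leftRegular h := fun h hh => by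
    rw [hx, mul_add, add_mul, ← leftRegular_mul, ← leftRegular_mul, ← leftRegular_mul,
      ← leftRegular_mul]
    rcases hconj h hh with e | e
    · have e' : h * z⁻¹ = z⁻¹ * h := by
        rw [eq_inv_mul_iff_mul_eq, ← mul_assoc, ← e, mul_inv_cancel_right]
      rw [e, e']
    · have e' : h * z⁻¹ = z * h := by
        rw [mul_inv_eq_iff_eq_mul, mul_assoc, e, mul_inv_cancel_left]
      rw [e, e', add_comm]
  have hxmem : x ∈ (groupVN Λ).center := mem_center.2
    ⟨add_mem (leftRegular_mem hzΛ) (leftRegular_mem (Λ.inv_mem hzΛ)),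
      fun a ha => (mem_groupVN_iff.1 ha x hcomm).symm⟩
  intro p hp hproj hp0
  by_contra! hmin
  obtain ⟨v, hv, c, hvc⟩ := (groupVN Λ).center.exists_apply_eq_smul_of_minimal
    (fun a ha b hb => (mem_center.1 hb).2 a (mem_center.1 ha).1) hp hproj hp0
    (fun q hq hqp hpq => or_iff_not_imp_left.2 (hmin q hq hqp hpq)) hxmem hsa
  exact hv (eq_zero_of_leftRegular_add_eq_smul hz hvc)

end GroupVNCenter

/-! ## The group of upper triangular integer matrices -/

section UpperTriangularInt

open Matrix

variable {n : ℕ}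

theorem isUnit_diag_of_mem_upperTriangular {R : Type*} [CommRing R]
    {h : Matrix.SpecialLinearGroup (Fin n) R} (hh : h ∈ upperTriangular n R) (i : Fin n) :
    IsUnit (h i i) := by
  have hdet := det_of_isUpperTriangular (M := (h : Matrix (Fin n) (Fin n) R))
    (fun i j hij => hh i j hij)
  rw [h.det_coe] at hdet
  exact isUnit_of_dvd_one
    ((Finset.dvd_prod_of_mem (fun k => h k k) (Finset.mem_univ i)).trans hdet.symm.dvd)

/-- Here `i` is the first index and `j` the last. Column `i` and row `j` of `h` vanish off the
diagonal, so `h E_ij = h_ii E_ij` and `E_ij h = h_jj E_ij`. -/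
theorem mul_transvection_eq_of_mem_upperTriangular {R : Type*} [CommRing R]
    {h : Matrix.SpecialLinearGroup (Fin n) R} (hh : h ∈ upperTriangular n R) {i j : Fin n}
    (hi : ∀ a, a ≠ i → i < a) (hj : ∀ a, a ≠ j → a < j) {c : R} (hc : h i i = c * h j j) :
    (h : Matrix (Fin n) (Fin n) R) * transvection i j 1 =
      transvection i j c * (h : Matrix (Fin n) (Fin n) R) := by
  ext a b
  by_cases ha : a = i
  · subst ha
    rw [transvection_mul_apply_same]
    by_cases hb : b = j
    · subst hb
      rw [mul_transvection_apply_same, one_mul, hc]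
    · rw [mul_transvection_apply_of_ne _ _ _ _ hb, hh j b (hj b hb), mul_zero, add_zero]
  · rw [transvection_mul_apply_of_ne _ _ _ _ ha]
    by_cases hb : b = j
    · subst hb
      rw [mul_transvection_apply_same, hh a i (hi a ha), mul_zero, add_zero]
    · rw [mul_transvection_apply_of_ne _ _ _ _ hb]

namespace FlagSpace

theorem coe_elementary_pow {i j : Fin n} (hij : j ≠ i) (k : ℕ) :
    ((elementary hij ^ k : Matrix.SpecialLinearGroup (Fin n) ℤ) : Matrix (Fin n) (Fin n) ℤ) =
      transvection j i (k : ℤ) := by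
  induction k with
  | zero => simp
  | succ k ih =>
    rw [pow_succ, Matrix.SpecialLinearGroup.coe_mul, ih]
    change _ * transvection j i 1 = _
    rw [transvection_mul_transvection_same _ _ hij]
    push_cast
    rfl

theorem not_isOfFinOrder_elementary {i j : Fin n} (hij : j ≠ i) :
    ¬ IsOfFinOrder (elementary hij) := fun h => by
  obtain ⟨k, hk, hk1⟩ := isOfFinOrder_iff_pow_eq_one.1 h
  have := congrArg (fun g : Matrix.SpecialLinearGroup (Fin n) ℤ =>
    (g : Matrix (Fin n) (Fin n) ℤ) j i) hk1
  rw [coe_elementary_pow, Matrix.SpecialLinearGroup.coe_one, transvection, Matrix.add_apply,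
    one_apply_ne hij, single_apply_same, zero_add] at this
  exact hk.ne' (by exact_mod_cast this)

theorem mul_elementary_of_mem_upperTriangular {i j : Fin n} (hij : j ≠ i)
    (hj : ∀ a, a ≠ j → j < a) (hi : ∀ a, a ≠ i → a < i)
    {h : Matrix.SpecialLinearGroup (Fin n) ℤ} (hh : h ∈ upperTriangular n ℤ) :
    h * elementary hij = elementary hij * h ∨ h * elementary hij = (elementary hij)⁻¹ * h := by
  -- The diagonal entries are units of `ℤ`, so any two of them agree up to sign.
  have hsign : h j j = 1 * h i i ∨ h j j = -1 * h i i := by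
    rcases Int.isUnit_iff.1 (isUnit_diag_of_mem_upperTriangular hh j) with e | e <;>
      rcases Int.isUnit_iff.1 (isUnit_diag_of_mem_upperTriangular hh i) with e' | e' <;>
      rw [e, e'] <;> decide
  refine hsign.imp (fun e => Subtype.ext ?_) fun e => ?_
  · rw [Matrix.SpecialLinearGroup.coe_mul, Matrix.SpecialLinearGroup.coe_mul]
    exact mul_transvection_eq_of_mem_upperTriangular hh hj hi e
  · rw [eq_inv_mul_iff_mul_eq]
    refine Subtype.ext ?_
    rw [Matrix.SpecialLinearGroup.coe_mul, Matrix.SpecialLinearGroup.coe_mul]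
    change transvection j i 1 * ((h : Matrix (Fin n) (Fin n) ℤ) * transvection j i 1) = _
    rw [mul_transvection_eq_of_mem_upperTriangular hh hj hi e, ← mul_assoc,
      transvection_mul_transvection_same _ _ hij, add_neg_cancel, transvection_zero, one_mul]

end FlagSpace

theorem isDiffuse_center_groupVN_upperTriangular (hn : 2 ≤ n) :
    (groupVN (upperTriangular n ℤ)).center.IsDiffuse := by
  let j : Fin n := ⟨0, by omega⟩
  let i : Fin n := ⟨n - 1, by omega⟩
  have hij : j < i := Fin.mk_lt_mk.2 (by omega)
  have hj : ∀ a, a ≠ j → j < a := fun a ha =>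
    lt_of_le_of_ne (Fin.mk_le_of_le_val (Nat.zero_le _)) ha.symm
  have hi : ∀ a, a ≠ i → a < i := fun a ha =>
    lt_of_le_of_ne (Fin.le_def.2 (Nat.le_sub_one_of_lt a.2)) ha
  exact isDiffuse_center_groupVN (FlagSpace.elementary_mem hij)
    (FlagSpace.not_isOfFinOrder_elementary hij.ne) fun h hh =>
    FlagSpace.mul_elementary_of_mem_upperTriangular hij.ne hj hi hh

end UpperTriangularInt

end

theorem proposition2p5 (n : ℕ) (hn : 2 ≤ n) :
    IsSingularSubgroup (upperTriangular n ℤ) (FlagSpace n) ∧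
    VonNeumannAlgebra.IsMaximalAmenable
      (groupVN (upperTriangular n ℤ))
      (groupVN (⊤ : Subgroup (Matrix.SpecialLinearGroup (Fin n) ℤ)))
      (diracOne (Matrix.SpecialLinearGroup (Fin n) ℤ)) ∧
    (groupVN (upperTriangular n ℤ)).center.IsDiffuse := by
  have : NeZero n := ⟨by omega⟩
  have := FlagSpace.compactSpace (n := n)
  refine ⟨FlagSpace.isSingularSubgroup, ⟨groupVN_mono le_top, ?_, fun A h1 h2 h3 => ?_⟩,
    isDiffuse_center_groupVN_upperTriangular hn⟩
  -- `diracOne` unfolds to `dirac 1`.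
  · exact isAmenable_groupVN (isAmenableGroup_upperTriangular n ℤ)
  · exact le_antisymm (le_groupVN_of_isAmenable (x := (FlagSpace.mk 1 : FlagSpace n))
      FlagSpace.continuous_int_smul (fun μ _ hμ => FlagSpace.ae_eq_base μ hμ)
      (fun g => FlagSpace.int_smul_base_eq.1) h1 h2 h3) h1
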